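/- Let $(\Omega,\mathcal F,\mu)$ be a complete $\sigma$-finite measure space, let $\mathcal A$ be its measure algebra ($\mathcal F$ modulo $\mu$-null symmetric differences, a complete Boolean algebra), and let $X$ be a real Banach space. **Conditional notions.** A *partition* in $\mathcal A$ is a pairwise disjoint family with supremum $1$. A *conditional set* on a non-empty set $V$ is a collection of objects $v|a$ ($v\in V$, $a\in\mathcal A$) such that $v|b=w|a$ implies $a=b$; $v|b=w|b$ and $a\le b$ imply $v|a=w|a$; and for every partition $(a_i)$ and every family $(v_i)$ in $V$ there is a unique $v=\sum v_i|a_i\in V$ with $v|a_i=v_i|a_i$ for all $i$. A function between conditional sets is *stable* if it preserves these concatenations $\sum v_i|a_i$. For a non-empty set $Z$, $Z_s$ denotes the conditional set of step functions $\sum z_i|a_i$ ($z_i\in Z$, $(a_i)$ a partition), two families being identified if $\bigvee\{a_i: z_i=z\}$ agree for all $z\in Z$; operations and relations on $Z$ extend to $Z_s$ stably (a relation holds between $\sum x_i|a_i$ and $\sum y_j|b_j$ if it holds between $x_i$ and $y_j$ whenever $a_i\wedge b_j>0$). A *conditional sequence* in $V$ is a stable function $\mathbb N_s\to V$. For a normed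 space $Z$, the *conditional completion* $Z_c$ consists of the conditional Cauchy sequences $(x_n)$ in $Z_s$ (for every $r>0$ in $\mathbb R_s$ there is $n_0\in\mathbb N_s$ with $\|x_m-x_n\|<r$ for all $m,n\ge n_0$), modulo sequences whose distance conditionally converges to $0$; the operations are $[(x_n)]+[(y_n)]=[(x_n+y_n)]$, $[(r_n)][(x_n)]=[(r_nx_n)]$, and $\|[(x_n)]\|_c=[(\|x_n\|)]$. Taking $Z=\mathbb R$ gives the *conditional real numbers* $R=\mathbb R_c$, ordered by: $[(x_n)]\le[(y_n)]$ if for all $r>0$ in $\mathbb R_s$ there is $n\in\mathbb N_s$ with $y_m-x_m>-r$ for all $m\ge n$; and $[(x_n)]<[(y_n)]$ if there are $r>0$ in $\mathbb R_s$ and $n\in\mathbb N_s$ with $y_m-x_m>r$ for all $m\ge n$. A *conditional Banach space* is a conditional set $V$ with stable operations $V\times V\to V$, $R\times V\to V$ satisfying the vector space axioms over $R$, and a stable norm $\|\cdot\|:V\to R_+$ with $\|x\|=0\iff x=0$, $\|rx\|=|r|\|x\|$, $\|x+y\|\le\|x\|+\|y\|$, in which every conditional Cauchy sequence (radii $r>0$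 in $R$, indices in $\mathbb N_s$) conditionally converges. **Theorem.** Let $L^0$ be the set of real-valued measurable functions, and $L^0(X)$ the set of strongly measurable functions $\Omega\to X$, in both cases modulo almost everywhere equality, where $x|a=y|a$ means $x1_A=y1_A$ a.e. for some $A\in a$. Then there is a bijection $L^0\to R$ which is stable together with its inverse and preserves sums, products, the unit, absolute values and the order, such that, with $L^0$ and $R$ identified along it: 1. $L^0(X)$, with the almost everywhere defined addition, scalar multiplication $(\alpha x)(\omega)=\alpha(\omega)x(\omega)$ and norm $\|x\|_0(\omega)=\|x(\omega)\|$, is a conditional Banach space; 2. $L^0(X)$ is conditionally isometrically isomorphic to $(X_c,\|\cdot\|_c)$: there is a bijection $j:L^0(X)\to X_c$, stable together with its inverse, which preserves addition, scalar multiplication and the norm. Moreover, $j$ can be chosen such that it maps the class of each constant function $x\in X$ to the constant step function $x|1$. -/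

import Mathlib

open MeasureTheory

universe u v w

noncomputable section

/-! ## Conditional sets over a complete Boolean algebra -/

/-- A partition in `A`: a pairwise disjoint family with supremum `1`
(members are allowed to be `0`). -/
def IsPartition {A : Type u} [CompleteBooleanAlgebra A] {ι : Type v} (a : ι → A) : Prop :=
  (∀ i j, i ≠ j → a i ⊓ a j = ⊥) ∧ ⨆ i, a i = ⊤

/-- The data underlying a conditional set of `X` and `A`: the objects are the pairs `x|a`,
where `x|a` and `y|b` are identified if and only if `a = b` and `agreeOn a x y`.
So `agreeOn a x y` means `x|a = y|a`. -/
class CondRestrict (A : Type u) (X : Type v) where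
  agreeOn : A → X → X → Prop

/-- The axioms of a conditional set. That `x|a = y|b` forces `a = b` is built into the encoding;
that equality of the objects `x|a` is an equality is `equivalence`; `consistency` and `stability`
are the two remaining axioms. (The index types of partitions live in the universe of `A`, which
is large enough, since distinct indices with nonzero entries have distinct entries.) -/
structure IsConditionalSet (A : Type u) [CompleteBooleanAlgebra A] (X : Type v)
    [CondRestrict A X] : Prop where
  nonempty : Nonempty X
  equivalence : ∀ a : A, Equivalence (fun x y : X => CondRestrict.agreeOn a x y)
  consistency : ∀ (a b : A) (x y : X), a ≤ b →
    CondRestrict.agreeOn b x y → CondRestrict.agreeOn a x y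
  stability : ∀ (ι : Type u) (a : ι → A), IsPartition a → ∀ x : ι → X,
    ∃! y : X, ∀ i, CondRestrict.agreeOn (a i) y (x i)

/-- A function is stable if it commutes with concatenations: if `y` is the concatenation of
`x i` along `a i`, then `f y` is the concatenation of `f (x i)` along `a i`. -/
def IsStable (A : Type u) [CompleteBooleanAlgebra A] {X : Type v} {Y : Type w}
    [CondRestrict A X] [CondRestrict A Y] (f : X → Y) : Prop :=
  ∀ (ι : Type u) (a : ι → A), IsPartition a → ∀ (x : ι → X) (y : X),
    (∀ i, CondRestrict.agreeOn (a i) y (x i)) →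
      ∀ i, CondRestrict.agreeOn (a i) (f y) (f (x i))

/-- The conditional Cartesian product. -/
instance instCondRestrictProd (A : Type u) (X : Type v) (Y : Type w)
    [CondRestrict A X] [CondRestrict A Y] : CondRestrict A (X × Y) where
  agreeOn a p q := CondRestrict.agreeOn a p.1 q.1 ∧ CondRestrict.agreeOn a p.2 q.2

/-! ## Step functions -/

/-- Step functions with values in `X`. The class of a family `(x i, a i)`, with `a` a partition, is
encoded by the function `z ↦ ⋁ {a i : x i = z}`, which is exactly the invariant by which families
are identified; conversely such a function `z ↦ coeff z` is itself a partition, indexed by `X`. -/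
@[ext] structure StepFun (A : Type u) [CompleteBooleanAlgebra A] (X : Type v) where
  coeff : X → A
  isPartition : IsPartition coeff

namespace StepFun

variable {A : Type u} [CompleteBooleanAlgebra A]

/-- The step function `∑ x i | a i`. -/
def ofFamily {ι : Type w} {X : Type v} (x : ι → X) (a : ι → A) (ha : IsPartition a) :
    StepFun A X where
  coeff z := ⨆ i, ⨆ _ : x i = z, a i
  isPartition := by
    constructor
    · intro s t hst
      simp only [iSup_inf_eq, inf_iSup_eq]
      simp only [iSup_eq_bot]
      intro i hi j hj
      apply ha.1
      rintro rfl
      exact hst (hj.symm.trans hi)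
    · rw [iSup_comm, ← ha.2]
      exact iSup_congr fun i => iSup_iSup_eq_right

theorem isPartition_inf {X : Type v} {Y : Type w} (x : StepFun A X) (y : StepFun A Y) :
    IsPartition (fun p : X × Y => x.coeff p.1 ⊓ y.coeff p.2) := by
  constructor
  · rintro ⟨s, t⟩ ⟨s', t'⟩ h
    by_cases hs : s = s'
    · have ht : t ≠ t' := by rintro rfl; exact h (by rw [hs])
      exact le_bot_iff.1 (le_trans (inf_le_inf inf_le_right inf_le_right)
        (y.isPartition.1 _ _ ht).le)
    · exact le_bot_iff.1 (le_trans (inf_le_inf inf_le_left inf_le_left)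
        (x.isPartition.1 _ _ hs).le)
  · rw [iSup_prod]
    simp only [← inf_iSup_eq, y.isPartition.2, inf_top_eq, x.isPartition.2]

/-- The constant step function `x|1`. -/
def const (A : Type u) [CompleteBooleanAlgebra A] {X : Type v} (x : X) : StepFun A X :=
  ofFamily (fun _ : Unit => x) (fun _ => ⊤)
    ⟨fun i j h => (h (Subsingleton.elim i j)).elim, by simp⟩

/-- `∑ x i | a i ↦ ∑ f (x i) | a i`. -/
def map {X : Type v} {Y : Type w} (f : X → Y) (x : StepFun A X) : StepFun A Y :=
  ofFamily f x.coeff x.isPartition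

/-- `(∑ x i | a i, ∑ y j | b j) ↦ ∑ f (x i) (y j) | a i ⊓ b j`. -/
def map₂ {X : Type*} {Y : Type*} {Z : Type*} (f : X → Y → Z) (x : StepFun A X)
    (y : StepFun A Y) : StepFun A Z :=
  ofFamily (fun p : X × Y => f p.1 p.2) (fun p => x.coeff p.1 ⊓ y.coeff p.2)
    (isPartition_inf x y)

/-- The relation `R` holds between `∑ x i | a i` and `∑ y j | b j` on `a`: one has `R (x i) (y j)`
for all `i`, `j` with `a ⊓ a i ⊓ b j > 0`. -/
def RelOn {X : Type v} {Y : Type w} (a : A) (R : X → Y → Prop) (x : StepFun A X)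
    (y : StepFun A Y) : Prop :=
  ∀ s t, a ⊓ (x.coeff s ⊓ y.coeff t) ≠ ⊥ → R s t

instance instLE {X : Type v} [LE X] : LE (StepFun A X) := ⟨RelOn ⊤ (· ≤ ·)⟩

/-- `x < y` means that `x` is strictly smaller than `y` on every nonzero condition. -/
instance instLT {X : Type v} [LT X] : LT (StepFun A X) := ⟨RelOn ⊤ (· < ·)⟩

/-- The conditional set of step functions. -/
instance instCondRestrict {X : Type v} : CondRestrict A (StepFun A X) where
  agreeOn a x y := ∀ z, x.coeff z ⊓ a = y.coeff z ⊓ a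

/-! Helper facts: computing with values of step functions on small conditions. -/

theorem exists_val {X : Type v} (x : StepFun A X) {b : A} (hb : b ≠ ⊥) :
    ∃ c ≤ b, c ≠ ⊥ ∧ ∃ s, c ≤ x.coeff s := by
  by_contra! h
  apply hb
  have h1 : b = ⨆ s, b ⊓ x.coeff s := by rw [← inf_iSup_eq, x.isPartition.2, inf_top_eq]
  rw [h1]
  simp only [iSup_eq_bot]
  intro s
  by_contra h2
  exact h _ inf_le_left h2 s inf_le_right

theorem val_unique {X : Type v} (x : StepFun A X) {b : A} (hb : b ≠ ⊥) {s t : X}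
    (hs : b ≤ x.coeff s) (ht : b ≤ x.coeff t) : s = t := by
  by_contra h
  exact hb (le_bot_iff.1 (le_trans (le_inf hs ht) (x.isPartition.1 _ _ h).le))

theorem val_const {X : Type v} (x : X) (b : A) : b ≤ (const A x).coeff x := by
  simp [const, ofFamily]

theorem val_map {X : Type v} {Y : Type w} (f : X → Y) (x : StepFun A X) {b : A} {s : X}
    (hs : b ≤ x.coeff s) : b ≤ (map f x).coeff (f s) :=
  le_trans hs (le_iSup_of_le s (le_iSup_of_le rfl le_rfl))

theorem val_map₂ {X : Type*} {Y : Type*} {Z : Type*} (f : X → Y → Z) (x : StepFun A X)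
    (y : StepFun A Y) {b : A} {s : X} {t : Y} (hs : b ≤ x.coeff s) (ht : b ≤ y.coeff t) :
    b ≤ (map₂ f x y).coeff (f s t) :=
  le_trans (le_inf hs ht) (le_iSup_of_le (s, t) (le_iSup_of_le rfl le_rfl))

theorem relOn_iff {X : Type v} {Y : Type w} {a : A} {R : X → Y → Prop} {x : StepFun A X}
    {y : StepFun A Y} : RelOn a R x y ↔
      ∀ b ≤ a, b ≠ ⊥ → ∀ s t, b ≤ x.coeff s → b ≤ y.coeff t → R s t := by
  constructor
  · intro h b hba hb s t hs ht
    exact h s t fun h0 => hb (le_bot_iff.1 (le_trans (le_inf hba (le_inf hs ht)) h0.le))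
  · intro h s t hne
    exact h _ inf_le_left hne s t (inf_le_right.trans inf_le_left) (inf_le_right.trans inf_le_right)

/-- It suffices to find values on arbitrarily small conditions. -/
theorem relOn_of_dense {X : Type v} {Y : Type w} {a : A} {R : X → Y → Prop} {x : StepFun A X}
    {y : StepFun A Y}
    (h : ∀ b ≤ a, b ≠ ⊥ → ∃ c ≤ b, c ≠ ⊥ ∧ ∃ s t, c ≤ x.coeff s ∧ c ≤ y.coeff t ∧ R s t) :
    RelOn a R x y := by
  rw [relOn_iff]
  intro b hba hb s t hs ht
  obtain ⟨c, hcb, hc, s', t', hs', ht', hR⟩ := h b hba hb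
  rw [val_unique x hc (hcb.trans hs) hs', val_unique y hc (hcb.trans ht) ht']
  exact hR

theorem RelOn.mono {X : Type v} {Y : Type w} {a b : A} {R : X → Y → Prop} {x : StepFun A X}
    {y : StepFun A Y} (hab : a ≤ b) (h : RelOn b R x y) : RelOn a R x y := by
  rw [relOn_iff] at h ⊢
  exact fun c hc => h c (hc.trans hab)

theorem agreeOn_iff {X : Type v} {a : A} {x y : StepFun A X} :
    CondRestrict.agreeOn a x y ↔ RelOn a (· = ·) x y := by
  constructor
  · intro h
    rw [relOn_iff]
    intro b hba hb s t hs ht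
    refine val_unique y hb ?_ ht
    exact (le_trans (le_inf hs hba) (h s).le).trans inf_le_left
  · intro h
    have key : ∀ (x y : StepFun A X), RelOn a (· = ·) x y →
        ∀ z, x.coeff z ⊓ a ≤ y.coeff z ⊓ a := by
      intro x y h z
      refine le_inf ?_ inf_le_right
      have h1 : x.coeff z ⊓ a = ⨆ t, (x.coeff z ⊓ a) ⊓ y.coeff t := by
        rw [← inf_iSup_eq, y.isPartition.2, inf_top_eq]
      rw [h1]
      refine iSup_le fun t => ?_
      by_cases h2 : (x.coeff z ⊓ a) ⊓ y.coeff t = ⊥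
      · rw [h2]; exact bot_le
      · have : z = t := (relOn_iff.1 h) _ (inf_le_left.trans inf_le_right) h2 z t
          (inf_le_left.trans inf_le_left) inf_le_right
        rw [this]; exact inf_le_right
    intro z
    refine le_antisymm (key x y h z) (key y x ?_ z)
    rw [relOn_iff] at h ⊢
    exact fun b hba hb s t hs ht => (h b hba hb t s ht hs).symm

theorem agreeOn_map {X : Type v} {Y : Type w} (f : X → Y) {a : A} {x x' : StepFun A X}
    (h : CondRestrict.agreeOn a x x') : CondRestrict.agreeOn a (map f x) (map f x') := by
  rw [agreeOn_iff] at h ⊢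
  apply relOn_of_dense
  intro b hba hb
  obtain ⟨c, hcb, hc, s, hs⟩ := x.exists_val hb
  obtain ⟨d, hdc, hd, s', hs'⟩ := x'.exists_val hc
  have := relOn_iff.1 h d (hdc.trans (hcb.trans hba)) hd s s' (hdc.trans hs) hs'
  exact ⟨d, hdc.trans hcb, hd, f s, f s', val_map f x (hdc.trans hs), val_map f x' hs',
    congrArg f this⟩

theorem agreeOn_map₂ {X : Type*} {Y : Type*} {Z : Type*} (f : X → Y → Z) {a : A}
    {x x' : StepFun A X} {y y' : StepFun A Y} (hx : CondRestrict.agreeOn a x x')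
    (hy : CondRestrict.agreeOn a y y') :
    CondRestrict.agreeOn a (map₂ f x y) (map₂ f x' y') := by
  rw [agreeOn_iff] at hx hy ⊢
  apply relOn_of_dense
  intro b hba hb
  obtain ⟨c, hcb, hc, s, hs⟩ := x.exists_val hb
  obtain ⟨d, hdc, hd, s', hs'⟩ := x'.exists_val hc
  obtain ⟨e, hed, he, t, ht⟩ := y.exists_val hd
  obtain ⟨g, hge, hg, t', ht'⟩ := y'.exists_val he
  have hgd := hge.trans hed
  have hgc := hgd.trans hdc
  have hga := hgc.trans (hcb.trans hba)
  have e1 := relOn_iff.1 hx g hga hg s s' (hgc.trans hs) (hgd.trans hs')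
  have e2 := relOn_iff.1 hy g hga hg t t' (hge.trans ht) ht'
  exact ⟨g, hgc.trans hcb, hg, f s t, f s' t', val_map₂ f x y (hgc.trans hs) (hge.trans ht),
    val_map₂ f x' y' (hgd.trans hs') ht', by rw [e1, e2]⟩

theorem le_trans' {x y z : StepFun A ℕ} (hxy : x ≤ y) (hyz : y ≤ z) : x ≤ z := by
  refine relOn_of_dense fun b hba hb => ?_
  obtain ⟨c, hcb, hc, s, hs⟩ := x.exists_val hb
  obtain ⟨d, hdc, hd, t, ht⟩ := y.exists_val hc
  obtain ⟨e, hed, he, r, hr⟩ := z.exists_val hd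
  exact ⟨e, hed.trans (hdc.trans hcb), he, s, r, (hed.trans hdc).trans hs, hr,
    (relOn_iff.1 hxy e le_top he s t ((hed.trans hdc).trans hs) (hed.trans ht)).trans
    (relOn_iff.1 hyz e le_top he t r (hed.trans ht) hr)⟩

theorem exists_upper (x y : StepFun A ℕ) : ∃ z, x ≤ z ∧ y ≤ z := by
  refine ⟨map₂ max x y, relOn_of_dense fun b hba hb => ?_, relOn_of_dense fun b hba hb => ?_⟩
  all_goals
    obtain ⟨c, hcb, hc, s, hs⟩ := x.exists_val hb
    obtain ⟨d, hdc, hd, t, ht⟩ := y.exists_val hc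
  · exact ⟨d, hdc.trans hcb, hd, s, max s t, hdc.trans hs, val_map₂ _ x y (hdc.trans hs) ht,
      le_max_left _ _⟩
  · exact ⟨d, hdc.trans hcb, hd, t, max s t, ht, val_map₂ _ x y (hdc.trans hs) ht,
      le_max_right _ _⟩

theorem pos_iff {r : StepFun A ℝ} :
    const A (0 : ℝ) < r ↔ ∀ b : A, b ≠ ⊥ → ∀ t, b ≤ r.coeff t → 0 < t := by
  change RelOn ⊤ _ _ _ ↔ _
  rw [relOn_iff]
  constructor
  · intro h b hb t ht
    exact h b le_top hb 0 t (val_const 0 b) ht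
  · intro h b _ hb s t hs ht
    rw [val_unique _ hb hs (val_const 0 b)]
    exact h b hb t ht

theorem pos_map {r : StepFun A ℝ} (hr : const A (0 : ℝ) < r) (f : ℝ → ℝ)
    (hf : ∀ t, 0 < t → 0 < f t) : const A (0 : ℝ) < map f r := by
  refine relOn_of_dense fun b _ hb => ?_
  obtain ⟨c, hcb, hc, s, hs⟩ := r.exists_val hb
  exact ⟨c, hcb, hc, 0, f s, val_const 0 c, val_map f r hs, hf s (pos_iff.1 hr c hc s hs)⟩

theorem const_pos {t : ℝ} (ht : 0 < t) : const A (0 : ℝ) < const A t := by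
  refine relOn_of_dense fun b _ hb => ?_
  exact ⟨b, le_rfl, hb, 0, t, val_const 0 b, val_const t b, ht⟩

/-- The metric `d_s` on step functions with values in a metric space. -/
def dist {X : Type v} [MetricSpace X] (x y : StepFun A X) : StepFun A ℝ :=
  map₂ Dist.dist x y

theorem relOn_dist_lt_iff {X : Type v} [MetricSpace X] {a : A} {x y : StepFun A X}
    {r : StepFun A ℝ} : RelOn a (· < ·) (dist x y) r ↔
      ∀ b ≤ a, b ≠ ⊥ → ∀ s t ρ, b ≤ x.coeff s → b ≤ y.coeff t → b ≤ r.coeff ρ →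
        Dist.dist s t < ρ := by
  constructor
  · intro h b hba hb s t ρ hs ht hρ
    exact relOn_iff.1 h b hba hb _ ρ (val_map₂ _ x y hs ht) hρ
  · intro h
    refine relOn_of_dense fun b hba hb => ?_
    obtain ⟨c, hcb, hc, s, hs⟩ := x.exists_val hb
    obtain ⟨d, hdc, hd, t, ht⟩ := y.exists_val hc
    obtain ⟨e, hed, he, ρ, hρ⟩ := r.exists_val hd
    exact ⟨e, hed.trans (hdc.trans hcb), he, _, ρ,
      val_map₂ _ x y ((hed.trans hdc).trans hs) (hed.trans ht), hρ,
      h e (hed.trans (hdc.trans (hcb.trans hba))) he s t ρ ((hed.trans hdc).trans hs)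
        (hed.trans ht) hρ⟩

end StepFun

/-! ## Conditional Cauchy sequences of step functions and the conditional completion -/

/-- A conditional Cauchy sequence in the conditional metric space of step functions: a stable
function on the conditional natural numbers `StepFun A ℕ` with the Cauchy property. The metric
takes values in the step functions `StepFun A ℝ`, and it is enough to test with radii in
`StepFun A ℝ`, since each conditional real number `> 0` dominates a step function `> 0`. -/
structure CondCauchySeq (A : Type u) [CompleteBooleanAlgebra A] (X : Type v)
    [MetricSpace X] where
  seq : StepFun A ℕ → StepFun A X
  stable : IsStable A seq
  cauchy : ∀ r : StepFun A ℝ, StepFun.const A 0 < r → ∃ k : StepFun A ℕ,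
    ∀ m n : StepFun A ℕ, k ≤ m → k ≤ n → StepFun.dist (seq m) (seq n) < r

namespace CondCauchySeq

variable {A : Type u} [CompleteBooleanAlgebra A]

/-- The distance of the two sequences conditionally converges to `0` on `a`. -/
def AsympOn {X : Type v} [MetricSpace X] (a : A) (x y : CondCauchySeq A X) : Prop :=
  ∀ r : StepFun A ℝ, StepFun.const A 0 < r → ∃ k : StepFun A ℕ,
    ∀ n : StepFun A ℕ, k ≤ n → StepFun.RelOn a (· < ·) (StepFun.dist (x.seq n) (y.seq n)) r

theorem asympOn_refl {X : Type v} [MetricSpace X] (a : A) (x : CondCauchySeq A X) :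
    AsympOn a x x := by
  intro r hr
  refine ⟨StepFun.const A 0, fun n _ => ?_⟩
  rw [StepFun.relOn_dist_lt_iff]
  intro b _ hb s t ρ hs ht hρ
  rw [StepFun.val_unique _ hb hs ht, dist_self]
  exact StepFun.pos_iff.1 hr b hb ρ hρ

theorem AsympOn.symm {X : Type v} [MetricSpace X] {a : A} {x y : CondCauchySeq A X}
    (h : AsympOn a x y) : AsympOn a y x := by
  intro r hr
  obtain ⟨k, hk⟩ := h r hr
  refine ⟨k, fun n hn => ?_⟩
  have := hk n hn
  rw [StepFun.relOn_dist_lt_iff] at this ⊢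
  intro b hba hb s t ρ hs ht hρ
  rw [dist_comm]
  exact this b hba hb t s ρ ht hs hρ

theorem AsympOn.trans {X : Type v} [MetricSpace X] {a : A} {x y z : CondCauchySeq A X}
    (hxy : AsympOn a x y) (hyz : AsympOn a y z) : AsympOn a x z := by
  intro r hr
  have hr2 := StepFun.pos_map hr (fun t => t / 2) (fun t ht => half_pos ht)
  obtain ⟨k, hk⟩ := hxy _ hr2
  obtain ⟨l, hl⟩ := hyz _ hr2
  obtain ⟨N, hkN, hlN⟩ := StepFun.exists_upper k l
  refine ⟨N, fun n hn => ?_⟩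
  have h1 := StepFun.relOn_dist_lt_iff.1 (hk n (StepFun.le_trans' hkN hn))
  have h2 := StepFun.relOn_dist_lt_iff.1 (hl n (StepFun.le_trans' hlN hn))
  rw [StepFun.relOn_dist_lt_iff]
  intro b hba hb s t ρ hs ht hρ
  obtain ⟨c, hcb, hc, q, hq⟩ := (y.seq n).exists_val hb
  have e1 := h1 c (hcb.trans hba) hc s q (ρ / 2) (hcb.trans hs) hq
    (StepFun.val_map (fun t => t / 2) r (hcb.trans hρ))
  have e2 := h2 c (hcb.trans hba) hc q t (ρ / 2) hq (hcb.trans ht)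
    (StepFun.val_map (fun t => t / 2) r (hcb.trans hρ))
  linarith [dist_triangle s q t]

theorem AsympOn.mono {X : Type v} [MetricSpace X] {a b : A} (hab : a ≤ b)
    {x y : CondCauchySeq A X} (h : AsympOn b x y) : AsympOn a x y := by
  intro r hr
  obtain ⟨k, hk⟩ := h r hr
  exact ⟨k, fun n hn => (hk n hn).mono hab⟩

/-- Two conditional Cauchy sequences are identified if their distance conditionally converges
to `0`. -/
instance instSetoid (X : Type v) [MetricSpace X] : Setoid (CondCauchySeq A X) where
  r := AsympOn ⊤
  iseqv := ⟨asympOn_refl ⊤, AsympOn.symm, AsympOn.trans⟩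

/-- The constant sequence of a step function. -/
def ofStep {X : Type v} [MetricSpace X] (x : StepFun A X) : CondCauchySeq A X where
  seq _ := x
  stable := fun _ _ _ _ _ _ _ _ => rfl
  cauchy := by
    intro r hr
    refine ⟨StepFun.const A 0, fun m n _ _ => ?_⟩
    refine StepFun.relOn_dist_lt_iff.2 ?_
    intro b _ hb s t ρ hs ht hρ
    rw [StepFun.val_unique _ hb hs ht, dist_self]
    exact StepFun.pos_iff.1 hr b hb ρ hρ

/-- Apply a nonexpansive function termwise. -/
def map {X : Type v} {Y : Type w} [MetricSpace X] [MetricSpace Y] (f : X → Y)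
    (hf : ∀ s t, dist (f s) (f t) ≤ dist s t) (x : CondCauchySeq A X) : CondCauchySeq A Y where
  seq n := StepFun.map f (x.seq n)
  stable := fun ι a ha y n hn i => StepFun.agreeOn_map f (x.stable ι a ha y n hn i)
  cauchy := by
    intro r hr
    obtain ⟨k, hk⟩ := x.cauchy r hr
    refine ⟨k, fun m n hm hn => ?_⟩
    have h := StepFun.relOn_dist_lt_iff.1 (hk m n hm hn)
    refine StepFun.relOn_dist_lt_iff.2 ?_
    intro b hba hb s t ρ hs ht hρ
    obtain ⟨c, hcb, hc, s', hs'⟩ := (x.seq m).exists_val hb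
    obtain ⟨d, hdc, hd, t', ht'⟩ := (x.seq n).exists_val hc
    rw [StepFun.val_unique _ hd (hdc.trans (hcb.trans hs)) (StepFun.val_map f _ (hdc.trans hs')),
      StepFun.val_unique _ hd (hdc.trans (hcb.trans ht)) (StepFun.val_map f _ ht')]
    exact (hf s' t').trans_lt (h d le_top hd s' t' ρ (hdc.trans hs') ht'
      (hdc.trans (hcb.trans hρ)))

theorem map_asympOn {X : Type v} {Y : Type w} [MetricSpace X] [MetricSpace Y] (f : X → Y)
    (hf : ∀ s t, dist (f s) (f t) ≤ dist s t) {a : A} {x y : CondCauchySeq A X}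
    (hxy : AsympOn a x y) : AsympOn a (map f hf x) (map f hf y) := by
  intro r hr
  obtain ⟨k, hk⟩ := hxy r hr
  refine ⟨k, fun n hn => ?_⟩
  have h := StepFun.relOn_dist_lt_iff.1 (hk n hn)
  refine StepFun.relOn_dist_lt_iff.2 ?_
  intro b hba hb s t ρ hs ht hρ
  obtain ⟨c, hcb, hc, s', hs'⟩ := (x.seq n).exists_val hb
  obtain ⟨d, hdc, hd, t', ht'⟩ := (y.seq n).exists_val hc
  rw [StepFun.val_unique _ hd (hdc.trans (hcb.trans hs)) (StepFun.val_map f _ (hdc.trans hs')),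
    StepFun.val_unique _ hd (hdc.trans (hcb.trans ht)) (StepFun.val_map f _ ht')]
  exact (hf s' t').trans_lt (h d ((hdc.trans hcb).trans hba) hd s' t' ρ (hdc.trans hs') ht'
    (hdc.trans (hcb.trans hρ)))

/-- Uniform continuity of a binary operation on products of unit balls, with a modulus `δ`
depending on the centres. -/
def LocallyUniform {X : Type*} {Y : Type*} {Z : Type*} [MetricSpace X] [MetricSpace Y]
    [MetricSpace Z] (f : X → Y → Z) : Prop :=
  ∀ (x₀ : X) (y₀ : Y) (ε : ℝ), 0 < ε → ∃ δ : ℝ, 0 < δ ∧ ∀ x x' y y',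
    dist x x₀ < 1 → dist x' x₀ < 1 → dist y y₀ < 1 → dist y' y₀ < 1 →
    dist x x' < δ → dist y y' < δ → dist (f x y) (f x' y') < ε

theorem LocallyUniform.exists_step {X : Type*} {Y : Type*} {Z : Type*} [MetricSpace X]
    [MetricSpace Y] [MetricSpace Z] {f : X → Y → Z} (hf : LocallyUniform f)
    (x₀ : StepFun A X) (y₀ : StepFun A Y) (r : StepFun A ℝ) (hr : StepFun.const A 0 < r) :
    ∃ δ : StepFun A ℝ, StepFun.const A 0 < δ ∧ ∀ b : A, b ≠ ⊥ → ∀ s₀ t₀ ρ,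
      b ≤ x₀.coeff s₀ → b ≤ y₀.coeff t₀ → b ≤ r.coeff ρ → ∃ η : ℝ, b ≤ δ.coeff η ∧
      ∀ x x' y y', dist x s₀ < 1 → dist x' s₀ < 1 → dist y t₀ < 1 → dist y' t₀ < 1 →
        dist x x' < η → dist y y' < η → dist (f x y) (f x' y') < ρ := by
  have : ∀ (p : X × Y) (ε : ℝ), ∃ δ : ℝ, 0 < ε → (0 < δ ∧ ∀ x x' y y',
      dist x p.1 < 1 → dist x' p.1 < 1 → dist y p.2 < 1 → dist y' p.2 < 1 →
      dist x x' < δ → dist y y' < δ → dist (f x y) (f x' y') < ε) := by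
    intro p ε
    by_cases hε : 0 < ε
    · obtain ⟨δ, h⟩ := hf p.1 p.2 ε hε
      exact ⟨δ, fun _ => h⟩
    · exact ⟨0, fun h => (hε h).elim⟩
  choose Δ hΔ using this
  refine ⟨StepFun.map₂ Δ (StepFun.map₂ Prod.mk x₀ y₀) r, ?_, ?_⟩
  · refine StepFun.relOn_of_dense fun b _ hb => ?_
    obtain ⟨c, hcb, hc, s, hs⟩ := x₀.exists_val hb
    obtain ⟨d, hdc, hd, t, ht⟩ := y₀.exists_val hc
    obtain ⟨e, hed, he, ρ, hρ⟩ := r.exists_val hd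
    exact ⟨e, hed.trans (hdc.trans hcb), he, 0, Δ (s, t) ρ, StepFun.val_const 0 e,
      StepFun.val_map₂ Δ _ _ (StepFun.val_map₂ Prod.mk _ _ ((hed.trans hdc).trans hs)
        (hed.trans ht)) hρ, (hΔ (s, t) ρ (StepFun.pos_iff.1 hr e he ρ hρ)).1⟩
  · intro b hb s₀ t₀ ρ hs ht hρ
    exact ⟨Δ (s₀, t₀) ρ, StepFun.val_map₂ Δ _ _ (StepFun.val_map₂ Prod.mk _ _ hs ht) hρ,
      (hΔ (s₀, t₀) ρ (StepFun.pos_iff.1 hr b hb ρ hρ)).2⟩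

/-- Apply a binary operation termwise: `(x n), (y n) ↦ (f (x n) (y n))`. -/
def map₂ {X : Type*} {Y : Type*} {Z : Type*} [MetricSpace X] [MetricSpace Y] [MetricSpace Z]
    (f : X → Y → Z) (hf : LocallyUniform f) (x : CondCauchySeq A X) (y : CondCauchySeq A Y) :
    CondCauchySeq A Z where
  seq n := StepFun.map₂ f (x.seq n) (y.seq n)
  stable := fun ι a ha z n hn i =>
    StepFun.agreeOn_map₂ f (x.stable ι a ha z n hn i) (y.stable ι a ha z n hn i)
  cauchy := by
    intro r hr
    obtain ⟨k₁, h₁⟩ := x.cauchy _ (StepFun.const_pos one_pos)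
    obtain ⟨k₂, h₂⟩ := y.cauchy _ (StepFun.const_pos one_pos)
    have le_self : ∀ k : StepFun A ℕ, k ≤ k := fun k => StepFun.relOn_iff.2
      fun b _ hb s t hs ht => (StepFun.val_unique k hb hs ht).le
    obtain ⟨δ, hδ, H⟩ := hf.exists_step (x.seq k₁) (y.seq k₂) r hr
    obtain ⟨k₃, h₃⟩ := x.cauchy δ hδ
    obtain ⟨k₄, h₄⟩ := y.cauchy δ hδ
    obtain ⟨K, hK₁, hK₂⟩ := StepFun.exists_upper k₁ k₂
    obtain ⟨L, hL₃, hL₄⟩ := StepFun.exists_upper k₃ k₄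
    obtain ⟨N, hKN, hLN⟩ := StepFun.exists_upper K L
    refine ⟨N, fun m n hm hn => ?_⟩
    have hKm := StepFun.le_trans' hKN hm
    have hKn := StepFun.le_trans' hKN hn
    have hLm := StepFun.le_trans' hLN hm
    have hLn := StepFun.le_trans' hLN hn
    have a1 := StepFun.relOn_dist_lt_iff.1 (h₁ m k₁ (StepFun.le_trans' hK₁ hKm) (le_self _))
    have a2 := StepFun.relOn_dist_lt_iff.1 (h₁ n k₁ (StepFun.le_trans' hK₁ hKn) (le_self _))
    have b1 := StepFun.relOn_dist_lt_iff.1 (h₂ m k₂ (StepFun.le_trans' hK₂ hKm) (le_self _))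
    have b2 := StepFun.relOn_dist_lt_iff.1 (h₂ n k₂ (StepFun.le_trans' hK₂ hKn) (le_self _))
    have c1 := StepFun.relOn_dist_lt_iff.1
      (h₃ m n (StepFun.le_trans' hL₃ hLm) (StepFun.le_trans' hL₃ hLn))
    have c2 := StepFun.relOn_dist_lt_iff.1
      (h₄ m n (StepFun.le_trans' hL₄ hLm) (StepFun.le_trans' hL₄ hLn))
    refine StepFun.relOn_dist_lt_iff.2 ?_
    intro b _ hb u u' ρ hu hu' hρ
    obtain ⟨g1, hg1, ng1, s, hs⟩ := (x.seq m).exists_val hb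
    obtain ⟨g2, hg2, ng2, s', hs'⟩ := (x.seq n).exists_val ng1
    obtain ⟨g3, hg3, ng3, t, ht⟩ := (y.seq m).exists_val ng2
    obtain ⟨g4, hg4, ng4, t', ht'⟩ := (y.seq n).exists_val ng3
    obtain ⟨g5, hg5, ng5, s₀, hs₀⟩ := (x.seq k₁).exists_val ng4
    obtain ⟨g, hg6, ng, t₀, ht₀⟩ := (y.seq k₂).exists_val ng5
    have i5 := hg6
    have i4 := i5.trans hg5
    have i3 := i4.trans hg4
    have i2 := i3.trans hg3
    have i1 := i2.trans hg2
    have i0 := i1.trans hg1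
    replace hs := i1.trans hs
    replace hs' := i2.trans hs'
    replace ht := i3.trans ht
    replace ht' := i4.trans ht'
    replace hs₀ := i5.trans hs₀
    rw [StepFun.val_unique _ ng (i0.trans hu) (StepFun.val_map₂ f _ _ hs ht),
      StepFun.val_unique _ ng (i0.trans hu') (StepFun.val_map₂ f _ _ hs' ht')]
    obtain ⟨η, hη, Hη⟩ := H g ng s₀ t₀ ρ hs₀ ht₀ (i0.trans hρ)
    exact Hη s s' t t' (a1 g le_top ng s s₀ 1 hs hs₀ (StepFun.val_const 1 g))
      (a2 g le_top ng s' s₀ 1 hs' hs₀ (StepFun.val_const 1 g))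
      (b1 g le_top ng t t₀ 1 ht ht₀ (StepFun.val_const 1 g))
      (b2 g le_top ng t' t₀ 1 ht' ht₀ (StepFun.val_const 1 g))
      (c1 g le_top ng s s' η hs hs' hη) (c2 g le_top ng t t' η ht ht' hη)

theorem map₂_asympOn {X : Type*} {Y : Type*} {Z : Type*} [MetricSpace X] [MetricSpace Y]
    [MetricSpace Z] (f : X → Y → Z) (hf : LocallyUniform f) {a : A} {x x' : CondCauchySeq A X}
    {y y' : CondCauchySeq A Y} (hx : AsympOn a x x') (hy : AsympOn a y y') :
    AsympOn a (map₂ f hf x y) (map₂ f hf x' y') := by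
  intro r hr
  have half : (0 : ℝ) < 1 / 2 := by norm_num
  obtain ⟨k₁, h₁⟩ := x.cauchy _ (StepFun.const_pos half)
  obtain ⟨k₂, h₂⟩ := y.cauchy _ (StepFun.const_pos half)
  have le_self : ∀ k : StepFun A ℕ, k ≤ k := fun k => StepFun.relOn_iff.2
    fun b _ hb s t hs ht => (StepFun.val_unique k hb hs ht).le
  obtain ⟨δ, hδ, H⟩ := hf.exists_step (x.seq k₁) (y.seq k₂) r hr
  obtain ⟨k₃, h₃⟩ := hx δ hδ
  obtain ⟨k₄, h₄⟩ := hy δ hδ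
  obtain ⟨k₅, h₅⟩ := hx _ (StepFun.const_pos half)
  obtain ⟨k₆, h₆⟩ := hy _ (StepFun.const_pos half)
  obtain ⟨K, hK₁, hK₂⟩ := StepFun.exists_upper k₁ k₂
  obtain ⟨L, hL₃, hL₄⟩ := StepFun.exists_upper k₃ k₄
  obtain ⟨M, hM₅, hM₆⟩ := StepFun.exists_upper k₅ k₆
  obtain ⟨N', hKN', hLN'⟩ := StepFun.exists_upper K L
  obtain ⟨N, hN'N, hMN⟩ := StepFun.exists_upper N' M
  refine ⟨N, fun n hn => ?_⟩
  have hN' := StepFun.le_trans' hN'N hn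
  have hKn := StepFun.le_trans' hKN' hN'
  have hLn := StepFun.le_trans' hLN' hN'
  have hMn := StepFun.le_trans' hMN hn
  have a1 := StepFun.relOn_dist_lt_iff.1 (h₁ n k₁ (StepFun.le_trans' hK₁ hKn) (le_self _))
  have b1 := StepFun.relOn_dist_lt_iff.1 (h₂ n k₂ (StepFun.le_trans' hK₂ hKn) (le_self _))
  have c1 := StepFun.relOn_dist_lt_iff.1 (h₃ n (StepFun.le_trans' hL₃ hLn))
  have c2 := StepFun.relOn_dist_lt_iff.1 (h₄ n (StepFun.le_trans' hL₄ hLn))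
  have d1 := StepFun.relOn_dist_lt_iff.1 (h₅ n (StepFun.le_trans' hM₅ hMn))
  have d2 := StepFun.relOn_dist_lt_iff.1 (h₆ n (StepFun.le_trans' hM₆ hMn))
  refine StepFun.relOn_dist_lt_iff.2 ?_
  intro b hba hb u u' ρ hu hu' hρ
  obtain ⟨g1, hg1, ng1, s, hs⟩ := (x.seq n).exists_val hb
  obtain ⟨g2, hg2, ng2, s', hs'⟩ := (x'.seq n).exists_val ng1
  obtain ⟨g3, hg3, ng3, t, ht⟩ := (y.seq n).exists_val ng2
  obtain ⟨g4, hg4, ng4, t', ht'⟩ := (y'.seq n).exists_val ng3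
  obtain ⟨g5, hg5, ng5, s₀, hs₀⟩ := (x.seq k₁).exists_val ng4
  obtain ⟨g, hg6, ng, t₀, ht₀⟩ := (y.seq k₂).exists_val ng5
  have i5 := hg6
  have i4 := i5.trans hg5
  have i3 := i4.trans hg4
  have i2 := i3.trans hg3
  have i1 := i2.trans hg2
  have i0 := i1.trans hg1
  have ia := i0.trans hba
  replace hs := i1.trans hs
  replace hs' := i2.trans hs'
  replace ht := i3.trans ht
  replace ht' := i4.trans ht'
  replace hs₀ := i5.trans hs₀
  have hh := StepFun.val_const (1 / 2 : ℝ) g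
  rw [StepFun.val_unique _ ng (i0.trans hu) (StepFun.val_map₂ f _ _ hs ht),
    StepFun.val_unique _ ng (i0.trans hu') (StepFun.val_map₂ f _ _ hs' ht')]
  obtain ⟨η, hη, Hη⟩ := H g ng s₀ t₀ ρ hs₀ ht₀ (i0.trans hρ)
  have e1 := a1 g le_top ng s s₀ _ hs hs₀ hh
  have e2 := b1 g le_top ng t t₀ _ ht ht₀ hh
  have e3 := d1 g ia ng s s' _ hs hs' hh
  have e4 := d2 g ia ng t t' _ ht ht' hh
  refine Hη s s' t t' (by linarith) ?_ (by linarith) ?_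
      (c1 g ia ng s s' η hs hs' hη) (c2 g ia ng t t' η ht ht' hη)
  · linarith [dist_triangle s' s s₀, dist_comm s' s]
  · linarith [dist_triangle t' t t₀, dist_comm t' t]

/-- For conditional Cauchy sequences in the step reals: there are `r > 0` and `n` such that
`y m - x m > r` for all `m ≥ n`. -/
def Lt (x y : CondCauchySeq A ℝ) : Prop :=
  ∃ r : StepFun A ℝ, StepFun.const A 0 < r ∧ ∃ n : StepFun A ℕ, ∀ m : StepFun A ℕ, n ≤ m →
    r < StepFun.map₂ (· - ·) (y.seq m) (x.seq m)

/-- For conditional Cauchy sequences in the step reals: for all `r > 0` there is `n` such that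
`y m - x m > -r` for all `m ≥ n`. -/
def Le (x y : CondCauchySeq A ℝ) : Prop :=
  ∀ r : StepFun A ℝ, StepFun.const A 0 < r → ∃ n : StepFun A ℕ, ∀ m : StepFun A ℕ, n ≤ m →
    StepFun.map (fun t => -t) r < StepFun.map₂ (· - ·) (y.seq m) (x.seq m)

theorem Lt.congr {x x' y y' : CondCauchySeq A ℝ} (hx : AsympOn ⊤ x x') (hy : AsympOn ⊤ y y')
    (h : Lt x y) : Lt x' y' := by
  obtain ⟨r, hr, k, hk⟩ := h
  have hr3 := StepFun.pos_map hr (fun t => t / 3) (fun t ht => by positivity)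
  obtain ⟨k₁, h₁⟩ := hx _ hr3
  obtain ⟨k₂, h₂⟩ := hy _ hr3
  obtain ⟨K, hK₁, hK₂⟩ := StepFun.exists_upper k₁ k₂
  obtain ⟨N, hKN, hkN⟩ := StepFun.exists_upper K k
  refine ⟨_, hr3, N, fun m hm => ?_⟩
  have hKm := StepFun.le_trans' hKN hm
  have a1 := StepFun.relOn_dist_lt_iff.1 (h₁ m (StepFun.le_trans' hK₁ hKm))
  have a2 := StepFun.relOn_dist_lt_iff.1 (h₂ m (StepFun.le_trans' hK₂ hKm))
  have a3 := StepFun.relOn_iff.1 (hk m (StepFun.le_trans' hkN hm))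
  refine StepFun.relOn_of_dense fun b hba hb => ?_
  obtain ⟨g1, hg1, ng1, s, hs⟩ := (x.seq m).exists_val hb
  obtain ⟨g2, hg2, ng2, s', hs'⟩ := (x'.seq m).exists_val ng1
  obtain ⟨g3, hg3, ng3, t, ht⟩ := (y.seq m).exists_val ng2
  obtain ⟨g4, hg4, ng4, t', ht'⟩ := (y'.seq m).exists_val ng3
  obtain ⟨g, hg5, ng, ρ, hρ⟩ := r.exists_val ng4
  have i4 := hg5
  have i3 := i4.trans hg4
  have i2 := i3.trans hg3
  have i1 := i2.trans hg2
  have i0 := i1.trans hg1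
  replace hs := i1.trans hs
  replace hs' := i2.trans hs'
  replace ht := i3.trans ht
  replace ht' := i4.trans ht'
  have hρ3 := StepFun.val_map (fun t => t / 3) r hρ
  refine ⟨g, i0, ng, ρ / 3, t' - s', hρ3, StepFun.val_map₂ (fun p q : ℝ => p - q) _ _ ht' hs', ?_⟩
  have e1 := a1 g le_top ng s s' _ hs hs' hρ3
  have e2 := a2 g le_top ng t t' _ ht ht' hρ3
  have e3 := a3 g le_top ng ρ (t - s) hρ (StepFun.val_map₂ (fun p q : ℝ => p - q) _ _ ht hs)
  rw [Real.dist_eq, abs_lt] at e1 e2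
  linarith [e1.1, e1.2, e2.1, e2.2]

theorem Le.congr {x x' y y' : CondCauchySeq A ℝ} (hx : AsympOn ⊤ x x') (hy : AsympOn ⊤ y y')
    (h : Le x y) : Le x' y' := by
  intro r hr
  have hr3 := StepFun.pos_map hr (fun t => t / 3) (fun t ht => by positivity)
  obtain ⟨k, hk⟩ := h _ hr3
  obtain ⟨k₁, h₁⟩ := hx _ hr3
  obtain ⟨k₂, h₂⟩ := hy _ hr3
  obtain ⟨K, hK₁, hK₂⟩ := StepFun.exists_upper k₁ k₂
  obtain ⟨N, hKN, hkN⟩ := StepFun.exists_upper K k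
  refine ⟨N, fun m hm => ?_⟩
  have hKm := StepFun.le_trans' hKN hm
  have a1 := StepFun.relOn_dist_lt_iff.1 (h₁ m (StepFun.le_trans' hK₁ hKm))
  have a2 := StepFun.relOn_dist_lt_iff.1 (h₂ m (StepFun.le_trans' hK₂ hKm))
  have a3 := StepFun.relOn_iff.1 (hk m (StepFun.le_trans' hkN hm))
  refine StepFun.relOn_of_dense fun b hba hb => ?_
  obtain ⟨g1, hg1, ng1, s, hs⟩ := (x.seq m).exists_val hb
  obtain ⟨g2, hg2, ng2, s', hs'⟩ := (x'.seq m).exists_val ng1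
  obtain ⟨g3, hg3, ng3, t, ht⟩ := (y.seq m).exists_val ng2
  obtain ⟨g4, hg4, ng4, t', ht'⟩ := (y'.seq m).exists_val ng3
  obtain ⟨g, hg5, ng, ρ, hρ⟩ := r.exists_val ng4
  have i4 := hg5
  have i3 := i4.trans hg4
  have i2 := i3.trans hg3
  have i1 := i2.trans hg2
  have i0 := i1.trans hg1
  replace hs := i1.trans hs
  replace hs' := i2.trans hs'
  replace ht := i3.trans ht
  replace ht' := i4.trans ht'
  have hρ3 := StepFun.val_map (fun t => t / 3) r hρ
  refine ⟨g, i0, ng, -ρ, t' - s', StepFun.val_map (fun t => -t) r hρ,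
    StepFun.val_map₂ (fun p q : ℝ => p - q) _ _ ht' hs', ?_⟩
  have e1 := a1 g le_top ng s s' _ hs hs' hρ3
  have e2 := a2 g le_top ng t t' _ ht ht' hρ3
  have e3 := a3 g le_top ng (-(ρ / 3)) (t - s) (StepFun.val_map (fun t => -t) _ hρ3)
    (StepFun.val_map₂ (fun p q : ℝ => p - q) _ _ ht hs)
  rw [Real.dist_eq, abs_lt] at e1 e2
  linarith [e1.1, e1.2, e2.1, e2.2]

theorem locallyUniform_add {E : Type v} [NormedAddCommGroup E] :
    LocallyUniform (fun x y : E => x + y) := by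
  intro x₀ y₀ ε hε
  refine ⟨ε / 2, half_pos hε, fun x x' y y' _ _ _ _ hx hy => ?_⟩
  linarith [dist_add_add_le x y x' y']

theorem locallyUniform_smul {E : Type v} [NormedAddCommGroup E] [NormedSpace ℝ E] :
    LocallyUniform (fun (r : ℝ) (x : E) => r • x) := by
  intro r₀ y₀ ε hε
  refine ⟨ε / (|r₀| + ‖y₀‖ + 2), by positivity, fun r r' y y' hr _ _ hy' h1 h2 => ?_⟩
  have hpos : 0 < |r₀| + ‖y₀‖ + 2 := by positivity
  rw [lt_div_iff₀ hpos] at h1 h2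
  have b1 : |r| ≤ |r₀| + 1 := by
    rw [Real.dist_eq] at hr
    linarith [abs_sub_abs_le_abs_sub r r₀]
  have b2 : ‖y'‖ ≤ ‖y₀‖ + 1 := by
    rw [dist_eq_norm] at hy'
    linarith [norm_sub_norm_le y' y₀]
  have e : r • y - r' • y' = r • (y - y') + (r - r') • y' := by
    rw [smul_sub, sub_smul]; abel
  rw [dist_eq_norm, e]
  have h3 := norm_add_le (r • (y - y')) ((r - r') • y')
  rw [norm_smul, norm_smul, Real.norm_eq_abs, Real.norm_eq_abs] at h3
  rw [Real.dist_eq] at h1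
  rw [dist_eq_norm] at h2
  have h4 : |r| * ‖y - y'‖ ≤ (|r₀| + 1) * ‖y - y'‖ := by gcongr
  have h5 : |r - r'| * ‖y'‖ ≤ |r - r'| * (‖y₀‖ + 1) := by gcongr
  have h6 : 0 ≤ ‖y - y'‖ := norm_nonneg _
  have h7 : 0 ≤ |r - r'| := abs_nonneg _
  have h8 : (|r₀| + 1) * ‖y - y'‖ + |r - r'| * (‖y₀‖ + 1)
      ≤ max ‖y - y'‖ |r - r'| * (|r₀| + ‖y₀‖ + 2) := by
    have m1 := le_max_left ‖y - y'‖ |r - r'|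
    have m2 := le_max_right ‖y - y'‖ |r - r'|
    have p1 : (|r₀| + 1) * ‖y - y'‖ ≤ (|r₀| + 1) * max ‖y - y'‖ |r - r'| := by gcongr
    have p2 : |r - r'| * (‖y₀‖ + 1) ≤ max ‖y - y'‖ |r - r'| * (‖y₀‖ + 1) := by gcongr
    linarith
  have h9 : max ‖y - y'‖ |r - r'| * (|r₀| + ‖y₀‖ + 2) < ε := by
    rcases max_choice ‖y - y'‖ |r - r'| with h | h <;> rw [h] <;> assumption
  linarith

end CondCauchySeq

/-- The conditional completion `X_c` of a metric space `X`: conditional Cauchy sequences of step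
functions modulo sequences at distance conditionally converging to `0`. -/
def CondCompletion (A : Type u) [CompleteBooleanAlgebra A] (X : Type v) [MetricSpace X] :
    Type (max u v) :=
  Quotient (CondCauchySeq.instSetoid (A := A) X)

/-- The conditional real numbers. -/
abbrev CondReal (A : Type u) [CompleteBooleanAlgebra A] : Type u := CondCompletion A ℝ

namespace CondCompletion

variable {A : Type u} [CompleteBooleanAlgebra A]

/-- The class of the constant sequence of a step function. -/
def ofStep {X : Type v} [MetricSpace X] (x : StepFun A X) : CondCompletion A X :=
  Quotient.mk _ (CondCauchySeq.ofStep x)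

/-- `[(x n)]|a = [(y n)]|a` if and only if the distance of `x n` and `y n` conditionally
converges to `0` on `a`. -/
instance instCondRestrict {X : Type v} [MetricSpace X] :
    CondRestrict A (CondCompletion A X) where
  agreeOn a := Quotient.lift₂ (CondCauchySeq.AsympOn a) fun _ _ _ _ hx hy =>
    propext ⟨fun h => ((CondCauchySeq.AsympOn.mono le_top hx).symm.trans h).trans
        (CondCauchySeq.AsympOn.mono le_top hy),
      fun h => ((CondCauchySeq.AsympOn.mono le_top hx).trans h).trans
        (CondCauchySeq.AsympOn.mono le_top hy).symm⟩

/-- `[(x n)] + [(y n)] = [(x n + y n)]`. -/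
instance instAdd {E : Type v} [NormedAddCommGroup E] : Add (CondCompletion A E) where
  add := Quotient.map₂ (CondCauchySeq.map₂ _ CondCauchySeq.locallyUniform_add)
    fun _ _ hx _ _ hy => CondCauchySeq.map₂_asympOn _ _ hx hy

instance instZero {E : Type v} [NormedAddCommGroup E] : Zero (CondCompletion A E) where
  zero := ofStep (StepFun.const A 0)

/-- `-[(x n)] = [(-x n)]`. -/
instance instNeg {E : Type v} [NormedAddCommGroup E] : Neg (CondCompletion A E) where
  neg := Quotient.map (CondCauchySeq.map (fun x => -x) fun s t => (dist_neg_neg s t).le)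
    fun _ _ hx => CondCauchySeq.map_asympOn _ _ hx

/-- `[(r n)] • [(x n)] = [(r n • x n)]`. For `E = ℝ` this is the multiplication of conditional
real numbers. -/
instance instSMul {E : Type v} [NormedAddCommGroup E] [NormedSpace ℝ E] :
    SMul (CondReal A) (CondCompletion A E) where
  smul := Quotient.map₂ (CondCauchySeq.map₂ _ CondCauchySeq.locallyUniform_smul)
    fun _ _ hx _ _ hy => CondCauchySeq.map₂_asympOn _ _ hx hy

instance instMul : Mul (CondReal A) := ⟨fun r s => r • s⟩

instance instOne : One (CondReal A) := ⟨ofStep (StepFun.const A 1)⟩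

/-- `‖[(x n)]‖ = [(‖x n‖)]`, a conditional real number. -/
def norm {E : Type v} [NormedAddCommGroup E] : CondCompletion A E → CondReal A :=
  Quotient.map (CondCauchySeq.map (fun x => ‖x‖) fun s t => by
      rw [Real.dist_eq, dist_eq_norm]; exact abs_norm_sub_norm_le s t)
    fun _ _ hx => CondCauchySeq.map_asympOn _ _ hx

/-- The absolute value `|[(x n)]| = [(|x n|)]` of conditional real numbers. -/
def abs (r : CondReal A) : CondReal A := norm r

instance instLE : LE (CondReal A) where
  le := Quotient.lift₂ CondCauchySeq.Le fun _ _ _ _ hx hy =>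
    propext ⟨CondCauchySeq.Le.congr hx hy,
      CondCauchySeq.Le.congr (CondCauchySeq.AsympOn.symm hx) (CondCauchySeq.AsympOn.symm hy)⟩

/-- The conditional strict order, that is, strict on every nonzero condition. -/
instance instLT : LT (CondReal A) where
  lt := Quotient.lift₂ CondCauchySeq.Lt fun _ _ _ _ hx hy =>
    propext ⟨CondCauchySeq.Lt.congr hx hy,
      CondCauchySeq.Lt.congr (CondCauchySeq.AsympOn.symm hx) (CondCauchySeq.AsympOn.symm hy)⟩

end CondCompletion

/-! ## Conditional Banach spaces -/

/-- The operations of a conditional normed space over the conditional real numbers (data only). -/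
structure CondNormedData (A : Type u) [CompleteBooleanAlgebra A] (V : Type v) where
  zero : V
  add : V → V → V
  neg : V → V
  smul : CondReal A → V → V
  norm : V → CondReal A

namespace CondNormedData

variable {A : Type u} [CompleteBooleanAlgebra A] {V : Type v} [CondRestrict A V]

/-- `V` is a conditional vector space: a conditional set with stable operations which satisfy the
vector space axioms over the conditional real numbers. -/
structure IsConditionalVectorSpace (S : CondNormedData A V) : Prop where
  conditionalSet : IsConditionalSet A V
  stable_add : IsStable A (fun p : V × V => S.add p.1 p.2)
  stable_smul : IsStable A (fun p : CondReal A × V => S.smul p.1 p.2)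
  add_assoc : ∀ x y z, S.add (S.add x y) z = S.add x (S.add y z)
  add_comm : ∀ x y, S.add x y = S.add y x
  add_zero : ∀ x, S.add x S.zero = x
  add_neg : ∀ x, S.add x (S.neg x) = S.zero
  smul_add : ∀ r x y, S.smul r (S.add x y) = S.add (S.smul r x) (S.smul r y)
  add_smul : ∀ r s x, S.smul (r + s) x = S.add (S.smul r x) (S.smul s x)
  mul_smul : ∀ r s x, S.smul (r * s) x = S.smul r (S.smul s x)
  one_smul : ∀ x, S.smul 1 x = x

/-- The norm is a conditional norm. -/
structure IsConditionalNorm (S : CondNormedData A V) : Prop where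
  stable_norm : IsStable A S.norm
  norm_nonneg : ∀ x, 0 ≤ S.norm x
  norm_eq_zero_iff : ∀ x, S.norm x = 0 ↔ x = S.zero
  norm_smul : ∀ r x, S.norm (S.smul r x) = CondCompletion.abs r * S.norm x
  norm_add_le : ∀ x y, S.norm (S.add x y) ≤ S.norm x + S.norm y

/-- The distance induced by the norm. -/
def dist (S : CondNormedData A V) (x y : V) : CondReal A := S.norm (S.add x (S.neg y))

/-- Every conditional Cauchy sequence (a stable function on the conditional natural numbers with
the Cauchy property) has a conditional limit. -/
def IsConditionallyComplete (S : CondNormedData A V) : Prop :=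
  ∀ x : StepFun A ℕ → V, IsStable A x →
    (∀ r : CondReal A, 0 < r → ∃ k : StepFun A ℕ, ∀ m n : StepFun A ℕ, k ≤ m → k ≤ n →
      S.dist (x m) (x n) < r) →
    ∃ l : V, ∀ r : CondReal A, 0 < r → ∃ k : StepFun A ℕ, ∀ n : StepFun A ℕ, k ≤ n →
      S.dist (x n) l < r

/-- Conditional Banach spaces. -/
structure IsConditionalBanachSpace (S : CondNormedData A V) : Prop where
  vectorSpace : S.IsConditionalVectorSpace
  norm : S.IsConditionalNorm
  complete : S.IsConditionallyComplete

/-- Conditional isometric isomorphisms of conditional normed spaces. -/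
structure IsConditionalIsometricIso {W : Type w} [CondRestrict A W] (S : CondNormedData A V)
    (T : CondNormedData A W) (j : V ≃ W) : Prop where
  stable : IsStable A j
  stable_symm : IsStable A j.symm
  map_add : ∀ x y, j (S.add x y) = T.add (j x) (j y)
  map_smul : ∀ r x, j (S.smul r x) = T.smul r (j x)
  norm_map : ∀ x, T.norm (j x) = S.norm x

end CondNormedData

/-- The operations and the norm of the conditional completion `E_c` of a normed space `E`. -/
def CondCompletion.normedData (A : Type u) [CompleteBooleanAlgebra A] (E : Type v)
    [NormedAddCommGroup E] [NormedSpace ℝ E] : CondNormedData A (CondCompletion A E) where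
  zero := 0
  add x y := x + y
  neg x := -x
  smul r x := r • x
  norm := CondCompletion.norm

/-! ## The measure algebra -/

/-- Two measurable sets are identified if their symmetric difference is a null set. -/
def measureAlgebraSetoid {Ω : Type u} [MeasurableSpace Ω] (μ : Measure Ω) :
    Setoid {s : Set Ω // MeasurableSet s} where
  r s t := μ (symmDiff s.1 t.1) = 0
  iseqv := by
    have h : ∀ s t : {s : Set Ω // MeasurableSet s},
        μ (symmDiff s.1 t.1) = 0 ↔ s.1 =ᵐ[μ] t.1 := fun s t => measure_symmDiff_eq_zero_iff
    refine ⟨fun s => ?_, fun {s t} hst => ?_, fun {s t r} hst htr => ?_⟩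
    · exact (h s s).2 Filter.EventuallyEq.rfl
    · rw [h] at *; exact hst.symm
    · rw [h] at *; exact hst.trans htr

/-- The measure algebra of a measure space. -/
def MeasureAlgebra {Ω : Type u} [MeasurableSpace Ω] (μ : Measure Ω) : Type u :=
  Quotient (measureAlgebraSetoid μ)

namespace MeasureAlgebra

variable {Ω : Type u} [MeasurableSpace Ω] {μ : Measure Ω}

/-- The class of a measurable set. -/
def mk (μ : Measure Ω) (s : {s : Set Ω // MeasurableSet s}) : MeasureAlgebra μ :=
  Quotient.mk (measureAlgebraSetoid μ) s

theorem equiv_iff {s t : {s : Set Ω // MeasurableSet s}} :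
    measureAlgebraSetoid μ s t ↔ s.1 =ᵐ[μ] t.1 :=
  measure_symmDiff_eq_zero_iff

instance instLE : LE (MeasureAlgebra μ) where
  le := Quotient.lift₂ (fun s t => s.1 ≤ᵐ[μ] t.1) fun _ _ _ _ h₁ h₂ =>
    propext ⟨fun h => (equiv_iff.1 h₁).symm.le.trans (h.trans (equiv_iff.1 h₂).le),
      fun h => (equiv_iff.1 h₁).le.trans (h.trans (equiv_iff.1 h₂).symm.le)⟩

theorem mk_le_mk {s t : {s : Set Ω // MeasurableSet s}} :
    mk μ s ≤ mk μ t ↔ s.1 ≤ᵐ[μ] t.1 := Iff.rfl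

instance instPartialOrder : PartialOrder (MeasureAlgebra μ) where
  le_refl a := by
    induction a using Quotient.inductionOn with
    | h s => exact Filter.EventuallyLE.refl _ _
  le_trans a b c := by
    induction a, b using Quotient.inductionOn₂ with
    | h s t =>
      induction c using Quotient.inductionOn with
      | h r => exact fun h h' => Filter.EventuallyLE.trans h h'
  le_antisymm a b := by
    induction a, b using Quotient.inductionOn₂ with
    | h s t => exact fun h h' => Quotient.sound (equiv_iff.2 (Filter.EventuallyLE.antisymm h h'))

instance instBooleanAlgebra : BooleanAlgebra (MeasureAlgebra μ) where
  sup := Quotient.map₂ (fun s t => ⟨s.1 ∪ t.1, s.2.union t.2⟩) fun _ _ h₁ _ _ h₂ =>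
    equiv_iff.2 ((equiv_iff.1 h₁).union (equiv_iff.1 h₂))
  inf := Quotient.map₂ (fun s t => ⟨s.1 ∩ t.1, s.2.inter t.2⟩) fun _ _ h₁ _ _ h₂ =>
    equiv_iff.2 ((equiv_iff.1 h₁).inter (equiv_iff.1 h₂))
  compl := Quotient.map (fun s => ⟨s.1ᶜ, s.2.compl⟩) fun _ _ h =>
    equiv_iff.2 (equiv_iff.1 h).compl
  top := mk μ ⟨Set.univ, MeasurableSet.univ⟩
  bot := mk μ ⟨∅, MeasurableSet.empty⟩
  le_sup_left a b := by
    induction a, b using Quotient.inductionOn₂ with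
    | h s t => exact mk_le_mk.2 (Filter.Eventually.of_forall fun _ h => Or.inl h)
  le_sup_right a b := by
    induction a, b using Quotient.inductionOn₂ with
    | h s t => exact mk_le_mk.2 (Filter.Eventually.of_forall fun _ h => Or.inr h)
  sup_le a b c := by
    induction a, b using Quotient.inductionOn₂ with
    | h s t =>
      induction c using Quotient.inductionOn with
      | h r =>
        intro h h'
        have h1 : s.1 ≤ᵐ[μ] r.1 := h
        have h2 : t.1 ≤ᵐ[μ] r.1 := h'
        refine mk_le_mk.2 ?_
        filter_upwards [h1, h2] with x hx hx'
        exact fun hh => hh.elim hx hx'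
  inf_le_left a b := by
    induction a, b using Quotient.inductionOn₂ with
    | h s t => exact mk_le_mk.2 (Filter.Eventually.of_forall fun _ h => h.1)
  inf_le_right a b := by
    induction a, b using Quotient.inductionOn₂ with
    | h s t => exact mk_le_mk.2 (Filter.Eventually.of_forall fun _ h => h.2)
  le_inf a b c := by
    induction a, b using Quotient.inductionOn₂ with
    | h s t =>
      induction c using Quotient.inductionOn with
      | h r =>
        intro h h'
        have h1 : s.1 ≤ᵐ[μ] t.1 := h
        have h2 : s.1 ≤ᵐ[μ] r.1 := h'
        refine mk_le_mk.2 ?_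
        filter_upwards [h1, h2] with x hx hx'
        exact fun hh => ⟨hx hh, hx' hh⟩
  le_sup_inf a b c := by
    induction a, b using Quotient.inductionOn₂ with
    | h s t =>
      induction c using Quotient.inductionOn with
      | h r =>
        refine mk_le_mk.2 (Filter.Eventually.of_forall fun x hx => ?_)
        have hx' : x ∈ (s.1 ∪ t.1) ∩ (s.1 ∪ r.1) := hx
        rwa [← Set.union_inter_distrib_left] at hx'
  le_top a := by
    induction a using Quotient.inductionOn with
    | h s => exact mk_le_mk.2 (Filter.Eventually.of_forall fun _ _ => trivial)
  bot_le a := by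
    induction a using Quotient.inductionOn with
    | h s => exact mk_le_mk.2 (Filter.Eventually.of_forall fun _ h => False.elim h)
  inf_compl_le_bot a := by
    induction a using Quotient.inductionOn with
    | h s => exact mk_le_mk.2 (Filter.Eventually.of_forall fun _ h => h.2 h.1)
  top_le_sup_compl a := by
    induction a using Quotient.inductionOn with
    | h s => exact mk_le_mk.2 (Filter.Eventually.of_forall fun x _ => Classical.em (x ∈ s.1))

/-- The measure algebra of a `σ`-finite measure is complete. -/
theorem exists_isLUB [SigmaFinite μ] (S : Set (MeasureAlgebra μ)) : ∃ a, IsLUB S a := by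
  obtain ⟨D, hDC, hD, h⟩ := Measure.exists_ae_subset_biUnion_countable μ
    (C := {s : Set Ω | ∃ hs : MeasurableSet s, mk μ ⟨s, hs⟩ ∈ S}) (fun s hs => hs.1)
  have hmeas : MeasurableSet (⋃₀ D) := MeasurableSet.sUnion hD fun s hs => (hDC hs).1
  refine ⟨mk μ ⟨⋃₀ D, hmeas⟩, ?_, ?_⟩
  · intro a ha
    induction a using Quotient.inductionOn with
    | h s =>
      refine mk_le_mk.2 ?_
      have := h s.1 ⟨s.2, ha⟩
      simpa [Set.sUnion_eq_biUnion] using this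
  · intro b hb
    induction b using Quotient.inductionOn with
    | h t =>
      refine mk_le_mk.2 ?_
      have : ∀ᵐ x ∂μ, ∀ s ∈ D, x ∈ s → x ∈ t.1 := by
        rw [ae_ball_iff hD]
        intro s hs
        obtain ⟨hms, hmS⟩ := hDC hs
        exact mk_le_mk.1 (hb hmS)
      filter_upwards [this] with x hx
      rintro ⟨s, hs, hxs⟩
      exact hx s hs hxs

instance instCompleteBooleanAlgebra [SigmaFinite μ] :
    CompleteBooleanAlgebra (MeasureAlgebra μ) where
  __ := instBooleanAlgebra
  sSup S := Classical.choose (exists_isLUB S)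
  isLUB_sSup S := Classical.choose_spec (exists_isLUB S)
  sInf S := Classical.choose (exists_isLUB (lowerBounds S))
  isGLB_sInf S := isLUB_lowerBounds.1 (Classical.choose_spec (exists_isLUB (lowerBounds S)))

end MeasureAlgebra

/-! ## The Bochner space `L⁰(E)` as a conditional set -/

/-- `Ω →ₘ[μ] E` is the set of classes of strongly measurable functions (almost everywhere limits
of simple functions) modulo almost everywhere equality. The objects satisfy
`x|a = y|a` if `x 1_s = y 1_s` almost everywhere for some measurable set `s` in the class `a`. -/
instance instCondRestrictAEEqFun {Ω : Type u} [MeasurableSpace Ω] (μ : Measure Ω) (E : Type v)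
    [TopologicalSpace E] : CondRestrict (MeasureAlgebra μ) (Ω →ₘ[μ] E) where
  agreeOn a x y := ∃ s : {s : Set Ω // MeasurableSet s}, MeasureAlgebra.mk μ s = a ∧
    ∀ᵐ ω ∂μ, ω ∈ s.1 → x ω = y ω

/-- A conditional isomorphism of conditionally ordered fields between `L⁰` (with the almost
everywhere operations and order) and the conditional real numbers over the measure algebra. It
is isometric, i.e. compatible with the absolute values. -/
structure IsCondRealIso {Ω : Type u} [MeasurableSpace Ω] (μ : Measure Ω) [SigmaFinite μ]
    (i : (Ω →ₘ[μ] ℝ) ≃ CondReal (MeasureAlgebra μ)) : Prop where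
  stable : IsStable (MeasureAlgebra μ) i
  stable_symm : IsStable (MeasureAlgebra μ) i.symm
  map_add : ∀ x y, i (x + y) = i x + i y
  map_mul : ∀ x y, i (x * y) = i x * i y
  map_one : i 1 = 1
  map_abs : ∀ x, i |x| = CondCompletion.abs (i x)
  le_iff : ∀ x y, i x ≤ i y ↔ x ≤ y

/-- The almost everywhere operations and norm on `L⁰(E)`, where `L⁰` and the conditional real
numbers are identified along `i`: `(r x)(ω) = r(ω) x(ω)` and `‖x‖(ω) = ‖x(ω)‖`. -/
def bochnerNormedData {Ω : Type u} [MeasurableSpace Ω] (μ : Measure Ω) [SigmaFinite μ]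
    (E : Type v) [NormedAddCommGroup E] [NormedSpace ℝ E]
    (i : (Ω →ₘ[μ] ℝ) ≃ CondReal (MeasureAlgebra μ)) :
    CondNormedData (MeasureAlgebra μ) (Ω →ₘ[μ] E) where
  zero := 0
  add x y := x + y
  neg x := -x
  smul r x := AEEqFun.comp₂ (fun (t : ℝ) (e : E) => t • e) continuous_smul (i.symm r) x
  norm x := i (AEEqFun.comp (fun e : E => ‖e‖) continuous_norm x)

end

/-! Over the measure algebra of a σ-finite measure, conditional statements turn into almost
everywhere statements. A partition has only countably many nonzero members, so a step function is
represented by a function `StepFun.toFun` on `Ω` that factors through a measurable map to `ℕ`. A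
relation holds between two step functions on the class of `t` exactly when it holds between the
representatives a.e. on `t` (`relOn_mk_iff`). A conditional natural number thus becomes a measurable
`ℕ`-valued function, and "there is `k` such that for all `n ≥ k`" becomes "for almost every `ω`, for
all large `n`", because the first good index depends measurably on `ω` (`exists_forall_ge_iff`).

Stability amounts to locality: on `{n = i}` the `n`-th member of a stable sequence coincides with
the member at the constant index `i` (`IsLocal.ae_eq`). A conditional Cauchy sequence is therefore
governed by the ordinary sequence of its members at constant indices, which is Cauchy at almost
every `ω`. If `X` is complete, this sequence has a strongly measurable a.e. limit. Two conditional
Cauchy sequences are identified on a condition exactly when their limits agree a.e. there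
(`asympOn_mk_iff`), and every strongly measurable function occurs as a limit, since it can be
approximated uniformly by countably valued functions (`exists_limit_eq`). So taking limits is a
bijection `equivAEEqFun` from the completion to the classes of strongly measurable functions.

This bijection is stable in both directions. It respects sums, products and norms because limits
commute with continuous maps, and it respects the order by `le_iff_limit_le` and `lt_iff_limit_lt`.
Its inverses for `ℝ` and for `E` are the two required maps. The algebraic and norm axioms of the
Bochner space then hold pointwise, and completeness repeats the scheme of locality, pointwise limit
and measurable choice of the index. -/

noncomputable section

open Filter Topology

/-! ### Representatives and partitions in the measure algebra. -/

namespace MeasureAlgebra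

variable {Ω : Type u} [MeasurableSpace Ω] {μ : Measure Ω}

theorem exists_mk (a : MeasureAlgebra μ) : ∃ s hs, mk μ ⟨s, hs⟩ = a := by
  obtain ⟨⟨s, hs⟩, h⟩ := Quotient.exists_rep a
  exact ⟨s, hs, h⟩

theorem mk_le_iff {s t : Set Ω} {hs : MeasurableSet s} {ht : MeasurableSet t} :
    mk μ ⟨s, hs⟩ ≤ mk μ ⟨t, ht⟩ ↔ ∀ᵐ ω ∂μ, ω ∈ s → ω ∈ t := Iff.rfl

theorem mk_inf {s t : Set Ω} (hs : MeasurableSet s) (ht : MeasurableSet t) :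
    mk μ ⟨s, hs⟩ ⊓ mk μ ⟨t, ht⟩ = mk μ ⟨s ∩ t, hs.inter ht⟩ := rfl

theorem mk_univ : mk μ ⟨Set.univ, MeasurableSet.univ⟩ = ⊤ := rfl

theorem mk_eq_bot_iff {s : Set Ω} {hs : MeasurableSet s} : mk μ ⟨s, hs⟩ = ⊥ ↔ μ s = 0 := by
  rw [← le_bot_iff]
  change mk μ ⟨s, hs⟩ ≤ mk μ ⟨∅, MeasurableSet.empty⟩ ↔ _
  rw [mk_le_iff, measure_eq_zero_iff_ae_notMem]
  rfl

theorem mk_eq_bot_iff_ae {s : Set Ω} {hs : MeasurableSet s} :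
    mk μ ⟨s, hs⟩ = ⊥ ↔ ∀ᵐ ω ∂μ, ω ∉ s := by
  rw [mk_eq_bot_iff, measure_eq_zero_iff_ae_notMem]

theorem mk_eq_mk_iff {s t : Set Ω} {hs : MeasurableSet s} {ht : MeasurableSet t} :
    mk μ ⟨s, hs⟩ = mk μ ⟨t, ht⟩ ↔ ∀ᵐ ω ∂μ, ω ∈ s ↔ ω ∈ t := by
  rw [le_antisymm_iff, mk_le_iff, mk_le_iff, ← eventually_and]
  exact eventually_congr (Eventually.of_forall fun ω => iff_def.symm)

/-- The level sets of a measurable function with countably many values cover everything. -/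
theorem iSup_mk_fiber [SigmaFinite μ] {ι : Type*} [Countable ι] [MeasurableSpace ι]
    [MeasurableSingletonClass ι] {u : Ω → ι} (hu : Measurable u) :
    ⨆ i, mk μ ⟨u ⁻¹' {i}, hu (measurableSet_singleton i)⟩ = ⊤ := by
  rw [eq_top_iff]
  obtain ⟨T, hT, hb⟩ := exists_mk (⨆ i, mk μ ⟨u ⁻¹' {i}, hu (measurableSet_singleton i)⟩)
  rw [← hb]
  have h : ∀ i, ∀ᵐ ω ∂μ, ω ∈ u ⁻¹' {i} → ω ∈ T := fun i =>
    mk_le_iff.1 (hb ▸ le_iSup (fun i => mk μ ⟨u ⁻¹' {i}, hu (measurableSet_singleton i)⟩) i)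
  rw [← mk_univ, mk_le_iff]
  filter_upwards [ae_all_iff.2 h] with ω hω _
  exact hω (u ω) rfl

/-- Representatives of disjoint elements meet in null sets, and a σ-finite measure has room for only
countably many such sets of positive measure. -/
theorem countable_ne_bot [SigmaFinite μ] {ι : Type*} {a : ι → MeasureAlgebra μ}
    (ha : ∀ i j, i ≠ j → a i ⊓ a j = ⊥) : {i | a i ≠ ⊥}.Countable := by
  choose s hs h using fun i => exists_mk (a i)
  have := Measure.countable_meas_pos_of_disjoint_iUnion₀ (μ := μ) (As := s)
    (fun i => (hs i).nullMeasurableSet) (fun i j hij => by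
      have := ha i j hij
      rw [← h, ← h, mk_inf, mk_eq_bot_iff] at this
      exact this)
  refine this.mono fun i hi => ?_
  rw [Set.mem_ofPred_eq, ← h, Ne, mk_eq_bot_iff] at hi
  exact pos_iff_ne_zero.2 hi

/-- Each partition in the measure algebra is refined by the level sets of a measurable
function with values in the natural numbers. -/
theorem exists_measurable_refinement [SigmaFinite μ] {ι : Type*} [Nonempty ι]
    {a : ι → MeasureAlgebra μ} (ha : IsPartition a) :
    ∃ (u : Ω → ℕ) (hu : Measurable u) (z : ℕ → ι),
      ∀ n, mk μ ⟨u ⁻¹' {n}, hu (measurableSet_singleton n)⟩ ≤ a (z n) := by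
  classical
  choose s hs h using fun i => exists_mk (a i)
  obtain ⟨z, hz⟩ : ∃ z : ℕ → ι, {i | a i ≠ ⊥} ⊆ Set.range z := by
    rcases Set.eq_empty_or_nonempty {i | a i ≠ ⊥} with h0 | h0
    -- No member is nonzero (the measure is then zero), so any enumeration will do.
    · exact ⟨fun _ => Classical.arbitrary ι, by simp [h0]⟩
    · obtain ⟨z, hz⟩ := (countable_ne_bot ha.1).exists_eq_range h0
      exact ⟨z, hz.le⟩
  have hU : MeasurableSet (⋃ n, s (z n)) := MeasurableSet.iUnion fun n => hs _
  have htop : mk μ ⟨_, hU⟩ = ⊤ := by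
    rw [eq_top_iff, ← ha.2]
    refine iSup_le fun i => ?_
    by_cases hi : a i = ⊥
    · rw [hi]; exact bot_le
    · obtain ⟨n, rfl⟩ := hz hi
      rw [← h, mk_le_iff]
      exact Eventually.of_forall fun ω hω => Set.mem_iUnion.2 ⟨n, hω⟩
  have hae : ∀ᵐ ω ∂μ, ω ∈ ⋃ n, s (z n) := by
    have := mk_le_iff.1 (mk_univ.trans htop.symm).le
    filter_upwards [this] with ω hω using hω trivial
  -- The second alternative makes the search succeed at every `ω`; it only takes effect on the null
  -- set outside the union, where the index found is `0`.
  have hex : ∀ ω, ∃ n, ω ∈ s (z n) ∨ ω ∉ ⋃ n, s (z n) := fun ω => by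
    by_cases hω : ω ∈ ⋃ n, s (z n)
    · obtain ⟨n, hn⟩ := Set.mem_iUnion.1 hω
      exact ⟨n, Or.inl hn⟩
    · exact ⟨0, Or.inr hω⟩
  have hu : Measurable fun ω => Nat.find (hex ω) :=
    measurable_find hex fun n => (hs (z n)).union hU.compl
  refine ⟨_, hu, z, fun n => ?_⟩
  rw [← h, mk_le_iff]
  filter_upwards [hae] with ω hω hn
  have h1 := Nat.find_spec (hex ω)
  rw [show Nat.find (hex ω) = n from hn] at h1
  exact h1.resolve_right fun h2 => h2 hω

end MeasureAlgebra

/-! ### Step functions as countably valued measurable functions. -/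

namespace StepFun

open MeasureAlgebra

section Algebra

variable {A : Type u} [CompleteBooleanAlgebra A] {X : Type v}

theorem agreeOn_refl (a : A) (x : StepFun A X) : CondRestrict.agreeOn a x x := fun _ => rfl

theorem isPartition_glue (s : ℕ → StepFun A X) (k : StepFun A ℕ) :
    IsPartition (fun p : ℕ × X => k.coeff p.1 ⊓ (s p.1).coeff p.2) := by
  constructor
  · rintro ⟨m, x⟩ ⟨n, y⟩ h
    by_cases hs : m = n
    · subst hs
      have ht : x ≠ y := by rintro rfl; exact h rfl
      exact le_bot_iff.1 (le_trans (inf_le_inf inf_le_right inf_le_right)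
        ((s m).isPartition.1 _ _ ht).le)
    · exact le_bot_iff.1 (le_trans (inf_le_inf inf_le_left inf_le_left)
        (k.isPartition.1 _ _ hs).le)
  · rw [iSup_prod]
    simp only [← inf_iSup_eq, (s _).isPartition.2, inf_top_eq, k.isPartition.2]

/-- The concatenation of the step functions `s n` along the partition `k`. -/
def glue (s : ℕ → StepFun A X) (k : StepFun A ℕ) : StepFun A X :=
  ofFamily (fun p : ℕ × X => p.2) _ (isPartition_glue s k)

theorem val_glue (s : ℕ → StepFun A X) (k : StepFun A ℕ) {b : A} {n : ℕ} {x : X}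
    (hn : b ≤ k.coeff n) (hx : b ≤ (s n).coeff x) : b ≤ (glue s k).coeff x :=
  le_trans (le_inf hn hx) (le_iSup_of_le (n, x) (le_iSup_of_le rfl le_rfl))

/-- On a small enough condition both indices have one common value `m`, and both concatenations
coincide there with `s m`. This is what makes `glue s` a stable sequence extending the ordinary
sequence `s`. -/
theorem agreeOn_glue (s : ℕ → StepFun A X) {a : A} {k l : StepFun A ℕ}
    (h : CondRestrict.agreeOn a k l) : CondRestrict.agreeOn a (glue s k) (glue s l) := by
  rw [agreeOn_iff] at h ⊢
  refine relOn_of_dense fun b hba hb => ?_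
  obtain ⟨c, hcb, hc, m, hm⟩ := k.exists_val hb
  obtain ⟨d, hdc, hd, n, hn⟩ := l.exists_val hc
  have hmn := relOn_iff.1 h d (hdc.trans (hcb.trans hba)) hd m n (hdc.trans hm) hn
  subst hmn
  obtain ⟨e, hed, he, x, hx⟩ := (s m).exists_val hd
  exact ⟨e, hed.trans (hdc.trans hcb), he, x, x, val_glue s k (hed.trans (hdc.trans hm)) hx,
    val_glue s l (hed.trans hn) hx, rfl⟩

end Algebra

variable {Ω : Type u} [MeasurableSpace Ω] {μ : Measure Ω} [SigmaFinite μ]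

section ToFun

variable {X : Type*} [Nonempty X]

/-- The function is `z ∘ u` for a refinement `u` of the partition. Where `z n ≠ e`, the level set `u
= n` lies below a coefficient disjoint from that of `e`, so it meets `t` in a null set; there are
countably many `n`. Quantifying over sets `t` below the coefficient avoids selecting representatives
for a possibly uncountable family. -/
theorem exists_measurable_repr (x : StepFun (MeasureAlgebra μ) X) :
    ∃ (u : Ω → ℕ) (z : ℕ → X), Measurable u ∧ ∀ (t : Set Ω) (ht : MeasurableSet t) (e : X),
      MeasureAlgebra.mk μ ⟨t, ht⟩ ≤ x.coeff e → ∀ᵐ ω ∂μ, ω ∈ t → z (u ω) = e := by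
  obtain ⟨u, hu, z, h⟩ := exists_measurable_refinement x.isPartition
  refine ⟨u, z, hu, fun t ht e hte => ?_⟩
  have : ∀ n, ∀ᵐ ω ∂μ, u ω = n → ω ∈ t → z n = e := fun n => by
    by_cases hn : z n = e
    · exact Eventually.of_forall fun _ _ _ => hn
    · have h0 := le_bot_iff.1 ((inf_le_inf (h n) hte).trans (x.isPartition.1 _ _ hn).le)
      rw [mk_inf, mk_eq_bot_iff_ae] at h0
      filter_upwards [h0] with ω hω h1 h2
      exact (hω ⟨h1, h2⟩).elim
  filter_upwards [ae_all_iff.2 this] with ω hω hωt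
  exact hω _ rfl hωt

/-- A function on `Ω` representing a step function over the measure algebra. -/
def toFun (x : StepFun (MeasureAlgebra μ) X) (ω : Ω) : X :=
  (exists_measurable_repr x).choose_spec.choose ((exists_measurable_repr x).choose ω)

theorem exists_toFun_eq (x : StepFun (MeasureAlgebra μ) X) :
    ∃ (u : Ω → ℕ) (z : ℕ → X), Measurable u ∧ toFun x = z ∘ u :=
  ⟨_, _, (exists_measurable_repr x).choose_spec.choose_spec.1, rfl⟩

theorem toFun_ae_eq {x : StepFun (MeasureAlgebra μ) X} {t : Set Ω} {ht : MeasurableSet t} {e : X}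
    (h : MeasureAlgebra.mk μ ⟨t, ht⟩ ≤ x.coeff e) : ∀ᵐ ω ∂μ, ω ∈ t → toFun x ω = e :=
  (exists_measurable_repr x).choose_spec.choose_spec.2 t ht e h

/-- The function factors measurably through `ℕ`, all of whose subsets are measurable, so no
σ-algebra on `X` is involved. -/
theorem measurableSet_toFun (x : StepFun (MeasureAlgebra μ) X) (p : X → Prop) :
    MeasurableSet {ω | p (toFun x ω)} := by
  obtain ⟨u, z, hu, h⟩ := exists_toFun_eq x
  rw [h]
  exact hu (MeasurableSet.of_discrete (s := {n | p (z n)}))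

/-- Converse of `toFun_ae_eq`. Otherwise some nonzero part of the level set lies outside the
coefficient of `e`, and on a smaller nonzero condition `x` has a value `e'`. The choice `e' = e`
contradicts being in the complement, and `e' ≠ e` contradicts `toFun_ae_eq`. -/
theorem mk_toFun_le (x : StepFun (MeasureAlgebra μ) X) (e : X) :
    MeasureAlgebra.mk μ ⟨{ω | toFun x ω = e}, measurableSet_toFun x (· = e)⟩ ≤ x.coeff e := by
  obtain ⟨t, ht, h⟩ := exists_mk (x.coeff e)ᶜ
  have hd : MeasureAlgebra.mk μ ⟨{ω | toFun x ω = e}, measurableSet_toFun x (· = e)⟩ ⊓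
      (x.coeff e)ᶜ = ⊥ := by
    by_contra hne
    obtain ⟨c, hc, hc0, e', he'⟩ := x.exists_val hne
    obtain ⟨s, hs, rfl⟩ := exists_mk c
    have h1 := toFun_ae_eq he'
    have h2 := mk_le_iff.1 (hc.trans inf_le_left)
    apply hc0
    by_cases hee : e' = e
    · subst hee
      exact le_bot_iff.1 ((le_inf he' (hc.trans inf_le_right)).trans (inf_compl_self _).le)
    · rw [mk_eq_bot_iff_ae]
      filter_upwards [h1, h2] with ω h1 h2 h3
      exact hee ((h1 h3).symm.trans (h2 h3))
  rwa [← disjoint_iff, disjoint_compl_right_iff] at hd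

/-- An almost everywhere property can be checked on the level sets of a step function. -/
theorem ae_of_level (x : StepFun (MeasureAlgebra μ) X) {p : X → Ω → Prop}
    (h : ∀ e, ∀ᵐ ω ∂μ, toFun x ω = e → p e ω) : ∀ᵐ ω ∂μ, p (toFun x ω) ω := by
  obtain ⟨u, z, hu, hx⟩ := exists_toFun_eq x
  filter_upwards [ae_all_iff.2 fun n => h (z n)] with ω hω
  simp only [hx, Function.comp_apply] at hω ⊢
  exact hω (u ω) rfl

theorem toFun_const (e : X) : ∀ᵐ ω ∂μ, toFun (const (MeasureAlgebra μ) e) ω = e := by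
  filter_upwards [toFun_ae_eq (ht := MeasurableSet.univ) (val_const (A := MeasureAlgebra μ) e _)]
    with ω h using h trivial

variable {Y : Type*} [Nonempty Y] {Z : Type*} [Nonempty Z]

theorem toFun_map (f : X → Y) (x : StepFun (MeasureAlgebra μ) X) :
    ∀ᵐ ω ∂μ, toFun (map f x) ω = f (toFun x ω) := by
  have := ae_of_level x (p := fun e ω => toFun (map f x) ω = f e) fun e =>
    toFun_ae_eq (val_map f x (mk_toFun_le x e))
  exact this

theorem toFun_map₂ (f : X → Y → Z) (x : StepFun (MeasureAlgebra μ) X)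
    (y : StepFun (MeasureAlgebra μ) Y) :
    ∀ᵐ ω ∂μ, toFun (map₂ f x y) ω = f (toFun x ω) (toFun y ω) := by
  refine ae_of_level x (p := fun e ω => toFun (map₂ f x y) ω = f e (toFun y ω)) fun e => ?_
  refine ae_of_level y
    (p := fun e' ω => toFun x ω = e → toFun (map₂ f x y) ω = f e e') fun e' => ?_
  have h := inf_le_inf (mk_toFun_le x e) (mk_toFun_le y e')
  rw [mk_inf] at h
  filter_upwards [toFun_ae_eq (val_map₂ f x y (h.trans inf_le_left) (h.trans inf_le_right))]
    with ω hω h1 h2 using hω ⟨h2, h1⟩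

/-- The dictionary between the Boolean and the pointwise picture. If the relation fails for a pair
of values, the condition on which both are taken within `t` vanishes in the algebra exactly when it
is null. Only countably many pairs occur among the representatives. -/
theorem relOn_mk_iff {t : Set Ω} {ht : MeasurableSet t} {R : X → Y → Prop}
    {x : StepFun (MeasureAlgebra μ) X} {y : StepFun (MeasureAlgebra μ) Y} :
    RelOn (MeasureAlgebra.mk μ ⟨t, ht⟩) R x y ↔ ∀ᵐ ω ∂μ, ω ∈ t → R (toFun x ω) (toFun y ω) := by
  constructor
  · intro h
    refine ae_of_level x (p := fun e ω => ω ∈ t → R e (toFun y ω)) fun e => ?_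
    refine ae_of_level y (p := fun e' ω => toFun x ω = e → ω ∈ t → R e e') fun e' => ?_
    by_cases hR : R e e'
    · exact Eventually.of_forall fun _ _ _ _ => hR
    · have h0 : MeasureAlgebra.mk μ ⟨t, ht⟩ ⊓ (x.coeff e ⊓ y.coeff e') = ⊥ := by
        by_contra h0
        exact hR (h e e' h0)
      have h1 := (inf_le_inf_left (MeasureAlgebra.mk μ ⟨t, ht⟩)
        (inf_le_inf (mk_toFun_le x e) (mk_toFun_le y e'))).trans h0.le
      rw [mk_inf, mk_inf, le_bot_iff, mk_eq_bot_iff_ae] at h1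
      filter_upwards [h1] with ω hω h2 h3 h4
      exact (hω ⟨h4, h3, h2⟩).elim
  · intro h e e' hne
    by_contra hR
    apply hne
    obtain ⟨s, hs, hse⟩ := exists_mk (x.coeff e)
    obtain ⟨s', hs', hse'⟩ := exists_mk (y.coeff e')
    have h1 := toFun_ae_eq hse.le
    have h2 := toFun_ae_eq hse'.le
    rw [← hse, ← hse', mk_inf, mk_inf, mk_eq_bot_iff_ae]
    filter_upwards [h, h1, h2] with ω h h1 h2 hω
    have := h hω.1
    rw [h1 hω.2.1, h2 hω.2.2] at this
    exact hR this

theorem relOn_top_iff {R : X → Y → Prop}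
    {x : StepFun (MeasureAlgebra μ) X} {y : StepFun (MeasureAlgebra μ) Y} :
    RelOn ⊤ R x y ↔ ∀ᵐ ω ∂μ, R (toFun x ω) (toFun y ω) := by
  rw [← mk_univ, relOn_mk_iff]
  simp

theorem agreeOn_mk_iff {t : Set Ω} {ht : MeasurableSet t}
    {x y : StepFun (MeasureAlgebra μ) X} :
    CondRestrict.agreeOn (MeasureAlgebra.mk μ ⟨t, ht⟩) x y ↔
      ∀ᵐ ω ∂μ, ω ∈ t → toFun x ω = toFun y ω := by
  rw [agreeOn_iff, relOn_mk_iff]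

theorem const_lt_iff {r : StepFun (MeasureAlgebra μ) ℝ} :
    const (MeasureAlgebra μ) 0 < r ↔ ∀ᵐ ω ∂μ, 0 < toFun r ω := by
  refine relOn_top_iff.trans (eventually_congr ?_)
  filter_upwards [toFun_const (μ := μ) (0 : ℝ)] with ω hω
  rw [hω]

theorem le_iff_ae {m n : StepFun (MeasureAlgebra μ) ℕ} :
    m ≤ n ↔ ∀ᵐ ω ∂μ, toFun m ω ≤ toFun n ω := relOn_top_iff

theorem toFun_glue (s : ℕ → StepFun (MeasureAlgebra μ) X) (k : StepFun (MeasureAlgebra μ) ℕ) :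
    ∀ᵐ ω ∂μ, toFun (glue s k) ω = toFun (s (toFun k ω)) ω := by
  refine ae_of_level k (p := fun n ω => toFun (glue s k) ω = toFun (s n) ω) fun n => ?_
  refine ae_of_level (s n) (p := fun e ω => toFun k ω = n → toFun (glue s k) ω = e) fun e => ?_
  have h := inf_le_inf (mk_toFun_le k n) (mk_toFun_le (s n) e)
  rw [mk_inf] at h
  filter_upwards [toFun_ae_eq (val_glue s k (h.trans inf_le_left) (h.trans inf_le_right))]
    with ω hω h1 h2 using hω ⟨h2, h1⟩

theorem stronglyMeasurable_toFun [TopologicalSpace X] (x : StepFun (MeasureAlgebra μ) X) :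
    StronglyMeasurable (toFun x) := by
  obtain ⟨u, z, hu, h⟩ := exists_toFun_eq x
  rw [h]
  exact (continuous_of_discreteTopology (f := z)).comp_stronglyMeasurable hu.stronglyMeasurable

variable (μ) in
/-- The step function with value `z n` on the level sets `u = n`. -/
def ofMeasurable {u : Ω → ℕ} (hu : Measurable u) (z : ℕ → X) : StepFun (MeasureAlgebra μ) X :=
  ofFamily z (fun n => MeasureAlgebra.mk μ ⟨u ⁻¹' {n}, hu (measurableSet_singleton n)⟩)
    ⟨fun i j hij => by
      rw [mk_inf, mk_eq_bot_iff_ae]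
      exact Eventually.of_forall fun ω h => hij (h.1.symm.trans h.2), iSup_mk_fiber hu⟩

theorem toFun_ofMeasurable {u : Ω → ℕ} (hu : Measurable u) (z : ℕ → X) :
    ∀ᵐ ω ∂μ, toFun (ofMeasurable μ hu z) ω = z (u ω) := by
  have : ∀ n, ∀ᵐ ω ∂μ, ω ∈ u ⁻¹' {n} → toFun (ofMeasurable μ hu z) ω = z n := fun n =>
    toFun_ae_eq (ht := hu (measurableSet_singleton n))
      (le_iSup_of_le n (le_iSup_of_le rfl le_rfl))
  filter_upwards [ae_all_iff.2 this] with ω hω using hω _ rfl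

end ToFun

/-- A property holds for all large conditional natural numbers if and only if it
holds pointwise for all large natural numbers. -/
theorem exists_forall_ge_iff {P : ℕ → Ω → Prop} (hP : ∀ n, NullMeasurableSet {ω | P n ω} μ) :
    (∃ k : StepFun (MeasureAlgebra μ) ℕ, ∀ n, k ≤ n → ∀ᵐ ω ∂μ, P (toFun n ω) ω) ↔
      ∀ᵐ ω ∂μ, ∀ᶠ n in atTop, P n ω := by
  classical
  constructor
  · rintro ⟨k, hk⟩
    -- The index `max i k` is admissible, being at least `k`, and equals `i` wherever `k ≤ i`. Each
    -- standard `i` costs one null set.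
    have h : ∀ i, ∀ᵐ ω ∂μ, toFun k ω ≤ i → P i ω := fun i => by
      have hle : k ≤ map (max i) k := by
        rw [le_iff_ae]
        filter_upwards [toFun_map (max i) k] with ω hω
        rw [hω]; exact le_max_right _ _
      filter_upwards [toFun_map (max i) k, hk _ hle] with ω h1 h2 h3
      rwa [h1, max_eq_left h3] at h2
    filter_upwards [ae_all_iff.2 h] with ω hω
    exact eventually_atTop.2 ⟨_, hω⟩
  · intro h
    -- The sets `P n` are only null measurable; replacing them by measurable versions makes the
    -- first good index measurable.
    obtain ⟨Q, hQ⟩ : ∃ Q : ℕ → Set Ω, ∀ n, MeasurableSet (Q n) ∧ ∀ᵐ ω ∂μ, ω ∈ Q n ↔ P n ω := by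
      choose Q h1 h2 using fun n => (hP n).exists_measurable_superset_ae_eq
      refine ⟨Q, fun n => ⟨(h2 n).1, ?_⟩⟩
      filter_upwards [(h2 n).2] with ω hω using iff_of_eq hω
    have hQe := ae_all_iff.2 fun n => (hQ n).2
    have hM : MeasurableSet {ω | ∃ k, ∀ n ≥ k, ω ∈ Q n} := by
      simp only [Set.ofPred_exists, Set.ofPred_forall]
      exact MeasurableSet.iUnion fun k => MeasurableSet.iInter fun n =>
        MeasurableSet.iInter fun _ => (hQ n).1
    -- The conditional index sought is the first `k` beyond which `Q` always holds; where no such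
    -- `k` exists, the second alternative yields `0`.
    have hex : ∀ ω, ∃ k, (∀ n ≥ k, ω ∈ Q n) ∨ ω ∉ {ω | ∃ k, ∀ n ≥ k, ω ∈ Q n} := fun ω => by
      by_cases hω : ω ∈ {ω | ∃ k, ∀ n ≥ k, ω ∈ Q n}
      · obtain ⟨k, hk⟩ := hω
        exact ⟨k, Or.inl hk⟩
      · exact ⟨0, Or.inr hω⟩
    have hu : Measurable fun ω => Nat.find (hex ω) := measurable_find hex fun k => by
      refine MeasurableSet.union (s₁ := {ω | ∀ n ≥ k, ω ∈ Q n}) ?_ hM.compl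
      simp only [Set.ofPred_forall]
      exact MeasurableSet.iInter fun n => MeasurableSet.iInter fun _ => (hQ n).1
    refine ⟨ofMeasurable μ hu id, fun n hn => ?_⟩
    filter_upwards [h, hQe, le_iff_ae.1 hn, toFun_ofMeasurable (μ := μ) hu id]
      with ω h hQe hn hk
    rw [hk] at hn
    rw [eventually_atTop] at h
    simp only [← hQe] at h ⊢
    exact (Nat.find_spec (hex ω)).resolve_right (not_not.2 h) _ hn

end StepFun

/-! ### Stability as compatibility with restriction. -/

section Stable

variable {A : Type u} [CompleteBooleanAlgebra A] {X : Type v} {Y : Type w} [CondRestrict A X]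
  [CondRestrict A Y] {f : X → Y}

theorem IsStable.of_agreeOn
    (h : ∀ (a : A) x y, CondRestrict.agreeOn a x y → CondRestrict.agreeOn a (f x) (f y)) :
    IsStable A f := fun _ a _ x y hy i => h (a i) y (x i) (hy i)

/-- Apply stability to the partition `a`, `aᶜ` and the family equal to `y` on `a` and `x` on `aᶜ`:
its concatenation is `x`. The lift of `Bool` places the index type in the universe of `A`. -/
theorem IsStable.agreeOn (hX : ∀ (a : A) (x : X), CondRestrict.agreeOn a x x) (hf : IsStable A f)
    {a : A} {x y : X} (h : CondRestrict.agreeOn a x y) :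
    CondRestrict.agreeOn a (f x) (f y) := by
  have hp : IsPartition fun i : ULift.{u} Bool => if i.down then a else aᶜ := by
    constructor
    · rintro ⟨i⟩ ⟨j⟩ hij
      cases i <;> cases j <;> simp_all
    · refine eq_top_iff.2 ((sup_compl_eq_top (x := a)).ge.trans (sup_le ?_ ?_))
      · exact le_iSup_of_le (ULift.up true) (by simp)
      · exact le_iSup_of_le (ULift.up false) (by simp)
  have := hf _ _ hp (fun i => if i.down then y else x) x (by
    rintro ⟨i⟩
    cases i
    · exact hX _ _
    · exact h) (ULift.up true)
  simpa using this

end Stable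

variable {Ω : Type u} [MeasurableSpace Ω] {μ : Measure Ω}

/-! ### Local families and approximation by step functions. -/

namespace StepFun

variable [SigmaFinite μ]

/-- A family of functions indexed by the conditional natural numbers is local if on each
condition it depends only on the index on this condition. -/
def IsLocal {X : Type*} (F : StepFun (MeasureAlgebra μ) ℕ → Ω → X) : Prop :=
  ∀ (t : Set Ω) (ht : MeasurableSet t) (m n : StepFun (MeasureAlgebra μ) ℕ),
    CondRestrict.agreeOn (MeasureAlgebra.mk μ ⟨t, ht⟩) m n → ∀ᵐ ω ∂μ, ω ∈ t → F m ω = F n ω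

/-- On `{n = i}` the index `n` agrees with the constant `i`, and these countably many sets cover
`Ω`. Hence members at constant indices determine all the others. -/
theorem IsLocal.ae_eq {X : Type*} {F : StepFun (MeasureAlgebra μ) ℕ → Ω → X} (hF : IsLocal F)
    (n : StepFun (MeasureAlgebra μ) ℕ) :
    ∀ᵐ ω ∂μ, F n ω = F (const (MeasureAlgebra μ) (toFun n ω)) ω := by
  refine ae_of_level n (p := fun i ω => F n ω = F (const (MeasureAlgebra μ) i) ω) fun i => ?_
  refine hF {ω | toFun n ω = i} (measurableSet_toFun n (· = i)) n _ ?_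
  rw [agreeOn_mk_iff]
  filter_upwards [toFun_const (μ := μ) i] with ω hω h
  rw [hω]; exact h

/-- The constant radii `1 / (j + 1)` and the indices `max i k` are enough to see the Cauchy property
at standard indices, so only countably many null sets are discarded. -/
theorem IsLocal.ae_cauchySeq {X : Type*} [PseudoMetricSpace X]
    {F : StepFun (MeasureAlgebra μ) ℕ → Ω → X} (hF : IsLocal F)
    (h : ∀ ε : ℝ, 0 < ε → ∃ k, ∀ m n, k ≤ m → k ≤ n → ∀ᵐ ω ∂μ, Dist.dist (F m ω) (F n ω) < ε) :
    ∀ᵐ ω ∂μ, CauchySeq fun i => F (const (MeasureAlgebra μ) i) ω := by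
  have key : ∀ j : ℕ, ∀ᵐ ω ∂μ, ∃ k, ∀ i i', k ≤ i → k ≤ i' →
      Dist.dist (F (const (MeasureAlgebra μ) i) ω) (F (const (MeasureAlgebra μ) i') ω) <
        1 / ((j : ℝ) + 1) := fun j => by
    obtain ⟨k, hk⟩ := h (1 / ((j : ℝ) + 1)) (by positivity)
    have hle : ∀ i, k ≤ map (max i) k := fun i => by
      rw [le_iff_ae]
      filter_upwards [toFun_map (max i) k] with ω hω
      rw [hω]; exact le_max_right _ _
    filter_upwards [ae_all_iff.2 fun i => ae_all_iff.2 fun i' => hk _ _ (hle i) (hle i'),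
      ae_all_iff.2 fun i => hF.ae_eq (map (max i) k),
      ae_all_iff.2 fun i => toFun_map (max i) k] with ω h1 h2 h3
    refine ⟨toFun k ω, fun i i' hi hi' => ?_⟩
    have h4 := h1 i i'
    rwa [h2, h2, h3, h3, max_eq_left hi, max_eq_left hi'] at h4
  filter_upwards [ae_all_iff.2 key] with ω hω
  refine Metric.cauchySeq_iff.2 fun ε hε => ?_
  obtain ⟨j, hj⟩ := exists_nat_one_div_lt hε
  obtain ⟨k, hk⟩ := hω j
  exact ⟨k, fun i hi i' hi' => (hk i i' hi hi').trans hj⟩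

/-- The range is separable: send each `ω` to the first term within `ε` of `f ω` in a sequence whose
closure contains the range. -/
theorem exists_dist_lt {X : Type*} [Nonempty X] [MetricSpace X] {f : Ω → X}
    (hf : StronglyMeasurable f) {ε : ℝ} (hε : 0 < ε) :
    ∃ s : StepFun (MeasureAlgebra μ) X, ∀ᵐ ω ∂μ, Dist.dist (toFun s ω) (f ω) < ε := by
  classical
  obtain ⟨c, hc, hfc⟩ := hf.isSeparable_range
  -- The set `c` may be empty when `Ω` is; the extra point allows it to be enumerated.
  obtain ⟨z, hz⟩ := (hc.insert (Classical.arbitrary X)).exists_eq_range (Set.insert_nonempty _ _)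
  have hex : ∀ ω, ∃ n, Dist.dist (z n) (f ω) < ε := fun ω => by
    obtain ⟨y, hy, hd⟩ := Metric.mem_closure_iff.1 (hfc ⟨ω, rfl⟩) ε hε
    obtain ⟨n, rfl⟩ := hz.le (Set.mem_insert_of_mem _ hy)
    exact ⟨n, by rwa [dist_comm]⟩
  have hu : Measurable fun ω => Nat.find (hex ω) := measurable_find hex fun n =>
    measurableSet_lt (stronglyMeasurable_const.dist hf).measurable measurable_const
  refine ⟨ofMeasurable μ hu z, ?_⟩
  filter_upwards [toFun_ofMeasurable (μ := μ) hu z] with ω hω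
  rw [hω]
  exact Nat.find_spec (hex ω)

end StepFun

/-! ### Pointwise limits of conditional Cauchy sequences. -/

namespace CondCauchySeq

open StepFun

variable [SigmaFinite μ] {X : Type*} [MetricSpace X] [Nonempty X]

theorem isLocal (x : CondCauchySeq (MeasureAlgebra μ) X) : IsLocal fun n => toFun (x.seq n) := by
  intro t ht m n h
  exact agreeOn_mk_iff.1 (x.stable.agreeOn agreeOn_refl h)

/-- The `i`-th function of a conditional sequence, for a standard index `i`. -/
def val (x : CondCauchySeq (MeasureAlgebra μ) X) (i : ℕ) : Ω → X :=
  toFun (x.seq (const (MeasureAlgebra μ) i))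

theorem toFun_seq (x : CondCauchySeq (MeasureAlgebra μ) X) (n : StepFun (MeasureAlgebra μ) ℕ) :
    ∀ᵐ ω ∂μ, toFun (x.seq n) ω = x.val (toFun n ω) ω := x.isLocal.ae_eq n

theorem stronglyMeasurable_val (x : CondCauchySeq (MeasureAlgebra μ) X) (i : ℕ) :
    StronglyMeasurable (x.val i) := stronglyMeasurable_toFun _

theorem ae_cauchySeq_val (x : CondCauchySeq (MeasureAlgebra μ) X) :
    ∀ᵐ ω ∂μ, CauchySeq fun i => x.val i ω := by
  refine x.isLocal.ae_cauchySeq fun ε hε => ?_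
  obtain ⟨k, hk⟩ := x.cauchy _ (const_pos hε)
  refine ⟨k, fun m n hm hn => ?_⟩
  filter_upwards [relOn_top_iff.1 (hk m n hm hn), toFun_map₂ Dist.dist (x.seq m) (x.seq n),
    toFun_const (μ := μ) ε] with ω h1 h2 h3
  rw [h3] at h1
  exact h2 ▸ h1

theorem exists_limit [CompleteSpace X] (x : CondCauchySeq (MeasureAlgebra μ) X) :
    ∃ f : Ω →ₘ[μ] X, ∀ᵐ ω ∂μ, Tendsto (fun i => x.val i ω) atTop (𝓝 (f ω)) := by
  obtain ⟨f, hf, h⟩ := exists_stronglyMeasurable_limit_of_tendsto_ae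
    (fun i => (x.stronglyMeasurable_val i).aestronglyMeasurable (μ := μ))
    (x.ae_cauchySeq_val.mono fun ω hω => cauchySeq_tendsto_of_complete hω)
  refine ⟨AEEqFun.mk f hf.aestronglyMeasurable, ?_⟩
  filter_upwards [h, AEEqFun.coeFn_mk f hf.aestronglyMeasurable] with ω h1 h2
  rwa [h2]

/-- The pointwise limit of a conditional Cauchy sequence. -/
def limit [CompleteSpace X] (x : CondCauchySeq (MeasureAlgebra μ) X) : Ω →ₘ[μ] X :=
  x.exists_limit.choose

theorem tendsto_limit [CompleteSpace X] (x : CondCauchySeq (MeasureAlgebra μ) X) :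
    ∀ᵐ ω ∂μ, Tendsto (fun i => x.val i ω) atTop (𝓝 (x.limit ω)) :=
  x.exists_limit.choose_spec

theorem limit_eq [CompleteSpace X] {x : CondCauchySeq (MeasureAlgebra μ) X} {f : Ω →ₘ[μ] X}
    (h : ∀ᵐ ω ∂μ, Tendsto (fun i => x.val i ω) atTop (𝓝 (f ω))) : x.limit = f := by
  refine AEEqFun.ext ?_
  filter_upwards [h, x.tendsto_limit] with ω h1 h2 using tendsto_nhds_unique h2 h1

/-- Locality expresses the members at a conditional index through those at constant indices;
`exists_forall_ge_iff` then moves the choice of the index inside the almost everywhere quantifier.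
-/
theorem asympOn_iff_eventually {t : Set Ω} {ht : MeasurableSet t}
    {x y : CondCauchySeq (MeasureAlgebra μ) X} :
    AsympOn (MeasureAlgebra.mk μ ⟨t, ht⟩) x y ↔
      ∀ r : StepFun (MeasureAlgebra μ) ℝ, const (MeasureAlgebra μ) 0 < r →
        ∀ᵐ ω ∂μ, ∀ᶠ i in atTop, ω ∈ t → Dist.dist (x.val i ω) (y.val i ω) < toFun r ω := by
  refine forall₂_congr fun r hr => ?_
  rw [← exists_forall_ge_iff fun i => ?_]
  · refine exists_congr fun k => forall₂_congr fun n hn => ?_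
    rw [relOn_mk_iff]
    refine eventually_congr ?_
    filter_upwards [x.toFun_seq n, y.toFun_seq n, toFun_map₂ Dist.dist (x.seq n) (y.seq n)]
      with ω h1 h2 h3
    rw [StepFun.dist, h3, h1, h2]
  · have : {ω | ω ∈ t → Dist.dist (x.val i ω) (y.val i ω) < toFun r ω} =
        tᶜ ∪ {ω | Dist.dist (x.val i ω) (y.val i ω) < toFun r ω} := by
      ext ω; simp [imp_iff_not_or]
    rw [this]
    exact (ht.compl.union (measurableSet_lt
      ((x.stronglyMeasurable_val i).dist (y.stronglyMeasurable_val i)).measurable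
      (stronglyMeasurable_toFun r).measurable)).nullMeasurableSet

/-- Radii `1 / (j + 1)` already force the limits to have distance `0`. Conversely, if the limits
agree at `ω`, the distances tend to `0` there and drop below the positive number `r ω`. -/
theorem asympOn_mk_iff [CompleteSpace X] {t : Set Ω} {ht : MeasurableSet t}
    {x y : CondCauchySeq (MeasureAlgebra μ) X} :
    AsympOn (MeasureAlgebra.mk μ ⟨t, ht⟩) x y ↔ ∀ᵐ ω ∂μ, ω ∈ t → x.limit ω = y.limit ω := by
  rw [asympOn_iff_eventually]
  constructor
  · intro h
    have h' := ae_all_iff.2 fun j : ℕ => h _ (const_pos (t := 1 / ((j : ℝ) + 1)) (by positivity))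
    filter_upwards [h', x.tendsto_limit, y.tendsto_limit,
      ae_all_iff.2 fun j : ℕ => toFun_const (μ := μ) (1 / ((j : ℝ) + 1))] with ω h hx hy hr ht
    rw [← dist_le_zero]
    refine le_of_forall_pos_le_add fun ε hε => ?_
    obtain ⟨j, hj⟩ := exists_nat_one_div_lt hε
    rw [zero_add]
    refine le_of_tendsto (hx.dist hy) ((h j).mono fun i hi => ?_)
    have := hi ht
    rw [hr] at this
    exact (this.trans hj).le
  · intro h r hr
    filter_upwards [h, x.tendsto_limit, y.tendsto_limit, const_lt_iff.1 hr] with ω h hx hy hr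
    by_cases hω : ω ∈ t
    · have hd := hx.dist hy
      rw [h hω, dist_self] at hd
      exact (hd.eventually_lt_const hr).mono fun i hi _ => hi
    · exact Eventually.of_forall fun i hi => (hω hi).elim

theorem asympOn_top_iff [CompleteSpace X] {x y : CondCauchySeq (MeasureAlgebra μ) X} :
    AsympOn ⊤ x y ↔ x.limit = y.limit := by
  rw [← MeasureAlgebra.mk_univ, asympOn_mk_iff]
  simp only [Set.mem_univ, true_imp_iff]
  exact ⟨AEEqFun.ext, fun h => by rw [h]; exact Eventually.of_forall fun _ => rfl⟩

/-- Take step functions within `1 / (n + 1)` of `f` and extend them to conditional indices by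
`glue`. At a conditional index `n` the error at `ω` is below `1 / (n ω + 1)`, which gives both the
Cauchy property and the limit. -/
theorem exists_limit_eq [CompleteSpace X] (f : Ω →ₘ[μ] X) :
    ∃ x : CondCauchySeq (MeasureAlgebra μ) X, x.limit = f := by
  choose s hs using fun n : ℕ =>
    exists_dist_lt (μ := μ) f.stronglyMeasurable (ε := 1 / ((n : ℝ) + 1)) (by positivity)
  have hlim : ∀ r : ℝ, 0 < r → ∀ᶠ n : ℕ in atTop, 1 / ((n : ℝ) + 1) < r := fun r hr =>
    tendsto_one_div_add_atTop_nhds_zero_nat.eventually_lt_const hr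
  have hdist : ∀ n, ∀ᵐ ω ∂μ,
      Dist.dist (toFun (glue s n) ω) (f ω) < 1 / (((toFun n ω : ℕ) : ℝ) + 1) :=
    fun n => by
      filter_upwards [toFun_glue s n, ae_all_iff.2 hs] with ω h1 h2
      rw [h1]; exact h2 _
  refine ⟨⟨glue s, IsStable.of_agreeOn fun a m n h => agreeOn_glue s h, fun r hr => ?_⟩,
    limit_eq ?_⟩
  -- Beyond `k` each error is below half the radius, so two members are within the radius by the
  -- triangle inequality through `f`.
  · obtain ⟨k, hk⟩ := (exists_forall_ge_iff (μ := μ)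
      (P := fun n ω => 1 / ((n : ℝ) + 1) < toFun r ω / 2) fun n =>
        (measurableSet_lt measurable_const
          ((stronglyMeasurable_toFun r).measurable.div_const 2)).nullMeasurableSet).2 (by
      filter_upwards [const_lt_iff.1 hr] with ω hω using hlim _ (half_pos hω))
    refine ⟨k, fun m n hm hn => relOn_top_iff.2 ?_⟩
    filter_upwards [hk m hm, hk n hn, hdist m, hdist n,
      toFun_map₂ Dist.dist (glue s m) (glue s n)] with ω h1 h2 h3 h4 h5
    rw [StepFun.dist, h5]
    linarith [dist_triangle_right (toFun (glue s m) ω) (toFun (glue s n) ω) (f ω)]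
  · filter_upwards [ae_all_iff.2 fun i : ℕ => hdist (const _ i),
      ae_all_iff.2 fun i : ℕ => toFun_const (μ := μ) i] with ω h1 h2
    refine tendsto_iff_dist_tendsto_zero.2 (squeeze_zero (fun _ => dist_nonneg) (fun i => ?_)
      tendsto_one_div_add_atTop_nhds_zero_nat)
    have := h1 i
    rw [h2] at this
    exact this.le

theorem limit_ofStep [CompleteSpace X] (e : X) :
    (ofStep (const (MeasureAlgebra μ) e)).limit = AEEqFun.const Ω e := by
  refine limit_eq ?_
  filter_upwards [toFun_const (μ := μ) e, AEEqFun.coeFn_const (μ := μ) Ω e] with ω h1 h2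
  rw [h2]
  exact tendsto_const_nhds.congr fun i => h1.symm

theorem limit_map {Y : Type*} [MetricSpace Y] [Nonempty Y] [CompleteSpace X] [CompleteSpace Y]
    (f : X → Y) (hf : ∀ s t, Dist.dist (f s) (f t) ≤ Dist.dist s t) (hc : Continuous f)
    (x : CondCauchySeq (MeasureAlgebra μ) X) :
    (map f hf x).limit = AEEqFun.comp f hc x.limit := by
  refine limit_eq ?_
  filter_upwards [x.tendsto_limit, AEEqFun.coeFn_comp f hc x.limit,
    ae_all_iff.2 fun i : ℕ => toFun_map f (x.seq (const _ i))] with ω h1 h2 h3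
  rw [h2]
  exact ((hc.tendsto _).comp h1).congr fun i => (h3 i).symm

/-- Local uniformity serves to make the combined sequence Cauchy; identifying its limit needs only
joint continuity. -/
theorem limit_map₂ {Y Z : Type*} [MetricSpace Y] [Nonempty Y] [CompleteSpace X] [CompleteSpace Y]
    [MetricSpace Z] [Nonempty Z] [CompleteSpace Z]
    (f : X → Y → Z) (hf : LocallyUniform f) (hc : Continuous (Function.uncurry f))
    (x : CondCauchySeq (MeasureAlgebra μ) X) (y : CondCauchySeq (MeasureAlgebra μ) Y) :
    (map₂ f hf x y).limit = AEEqFun.comp₂ f hc x.limit y.limit := by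
  refine limit_eq ?_
  filter_upwards [x.tendsto_limit, y.tendsto_limit, AEEqFun.coeFn_comp₂ f hc x.limit y.limit,
    ae_all_iff.2 fun i : ℕ => toFun_map₂ f (x.seq (const _ i)) (y.seq (const _ i))]
    with ω h1 h2 h3 h4
  rw [h3]
  exact ((hc.tendsto (x.limit ω, y.limit ω)).comp (h1.prodMk_nhds h2)).congr
    fun i => (h4 i).symm

/-- Constant radii `1 / (j + 1)` show that the limiting difference is at least `-ε` for every `ε >
0`. Conversely, a nonnegative limit exceeds `-r ω`, so the differences eventually do too. -/
theorem le_iff_limit_le {x y : CondCauchySeq (MeasureAlgebra μ) ℝ} :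
    Le x y ↔ ∀ᵐ ω ∂μ, x.limit ω ≤ y.limit ω := by
  have h : Le x y ↔ ∀ r : StepFun (MeasureAlgebra μ) ℝ, const (MeasureAlgebra μ) 0 < r →
      ∀ᵐ ω ∂μ, ∀ᶠ i in atTop, -toFun r ω < y.val i ω - x.val i ω := by
    refine forall₂_congr fun r hr => ?_
    rw [← exists_forall_ge_iff (P := fun i ω => -toFun r ω < y.val i ω - x.val i ω)
      fun i => (measurableSet_lt (stronglyMeasurable_toFun r).measurable.neg
        ((y.stronglyMeasurable_val i).sub (x.stronglyMeasurable_val i)).measurable).nullMeasurableSet]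
    refine exists_congr fun k => forall₂_congr fun n hn => relOn_top_iff.trans ?_
    refine eventually_congr ?_
    filter_upwards [x.toFun_seq n, y.toFun_seq n, toFun_map (fun t => -t) r,
      toFun_map₂ (fun s t : ℝ => s - t) (y.seq n) (x.seq n)] with ω h1 h2 h3 h4
    rw [h3, h4, h1, h2]
  rw [h]
  constructor
  · intro h
    have h' := ae_all_iff.2 fun j : ℕ => h _ (const_pos (t := 1 / ((j : ℝ) + 1)) (by positivity))
    filter_upwards [h', x.tendsto_limit, y.tendsto_limit,
      ae_all_iff.2 fun j : ℕ => toFun_const (μ := μ) (1 / ((j : ℝ) + 1))] with ω h hx hy hr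
    rw [← sub_nonneg]
    refine le_of_forall_pos_le_add fun ε hε => ?_
    obtain ⟨j, hj⟩ := exists_nat_one_div_lt hε
    rw [← neg_le_iff_add_nonneg]
    refine ge_of_tendsto (hy.sub hx) ((h j).mono fun i hi => ?_)
    rw [hr] at hi
    linarith
  · intro h r hr
    filter_upwards [h, x.tendsto_limit, y.tendsto_limit, const_lt_iff.1 hr] with ω h hx hy hr
    exact (hy.sub hx).eventually_const_lt (by linarith)

/-- A step function `r` below the differences stays weakly below their limit, so the limit is
positive. The converse needs a step function strictly between `0` and the limiting gap, which varies
with `ω` and need not be bounded away from `0`. -/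
theorem lt_iff_limit_lt {x y : CondCauchySeq (MeasureAlgebra μ) ℝ} :
    Lt x y ↔ ∀ᵐ ω ∂μ, x.limit ω < y.limit ω := by
  classical
  have h : Lt x y ↔ ∃ r : StepFun (MeasureAlgebra μ) ℝ, const (MeasureAlgebra μ) 0 < r ∧
      ∀ᵐ ω ∂μ, ∀ᶠ i in atTop, toFun r ω < y.val i ω - x.val i ω := by
    refine exists_congr fun r => and_congr_right fun hr => ?_
    rw [← exists_forall_ge_iff (P := fun i ω => toFun r ω < y.val i ω - x.val i ω)
      fun i => (measurableSet_lt (stronglyMeasurable_toFun r).measurable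
        ((y.stronglyMeasurable_val i).sub (x.stronglyMeasurable_val i)).measurable).nullMeasurableSet]
    refine exists_congr fun k => forall₂_congr fun n hn => relOn_top_iff.trans ?_
    refine eventually_congr ?_
    filter_upwards [x.toFun_seq n, y.toFun_seq n,
      toFun_map₂ (fun s t : ℝ => s - t) (y.seq n) (x.seq n)] with ω h1 h2 h4
    rw [h4, h1, h2]
  rw [h]
  constructor
  · rintro ⟨r, hr, h⟩
    filter_upwards [h, x.tendsto_limit, y.tendsto_limit, const_lt_iff.1 hr] with ω h hx hy hr
    have := ge_of_tendsto (hy.sub hx) (h.mono fun i hi => hi.le)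
    linarith
  · intro h
    -- The separating step function is `1 / (n + 1)` for the first `n` that puts it below the gap;
    -- on the null set with no positive gap `n` is `0`.
    have hex : ∀ ω, ∃ n : ℕ, 1 / ((n : ℝ) + 1) < y.limit ω - x.limit ω ∨
        ¬ 0 < y.limit ω - x.limit ω := fun ω => by
      by_cases hω : 0 < y.limit ω - x.limit ω
      · obtain ⟨n, hn⟩ := exists_nat_one_div_lt hω
        exact ⟨n, Or.inl hn⟩
      · exact ⟨0, Or.inr hω⟩
    have hm : Measurable fun ω => y.limit ω - x.limit ω :=
      y.limit.measurable.sub x.limit.measurable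
    have hu : Measurable fun ω => Nat.find (hex ω) := measurable_find hex fun n =>
      (measurableSet_lt measurable_const hm).union (measurableSet_lt measurable_const hm).compl
    have hr := toFun_ofMeasurable (μ := μ) hu fun n => 1 / ((n : ℝ) + 1)
    refine ⟨ofMeasurable μ hu fun n => 1 / ((n : ℝ) + 1), const_lt_iff.2 ?_, ?_⟩
    · filter_upwards [hr] with ω hω
      rw [hω]; positivity
    · filter_upwards [hr, h, x.tendsto_limit, y.tendsto_limit] with ω hr h hx hy
      refine (hy.sub hx).eventually_const_lt ?_
      rw [hr]
      exact (Nat.find_spec (hex ω)).resolve_right (not_not.2 (sub_pos.2 h))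

end CondCauchySeq

/-! ### The completion identified with strongly measurable functions. -/

namespace CondCompletion

variable [SigmaFinite μ] {X : Type*} [MetricSpace X] [Nonempty X] [CompleteSpace X]

variable (μ X) in
/-- The conditional completion over the measure algebra consists of the classes of strongly
measurable functions: a conditional Cauchy sequence is sent to its pointwise limit. -/
def equivAEEqFun : CondCompletion (MeasureAlgebra μ) X ≃ (Ω →ₘ[μ] X) :=
  Equiv.ofBijective
    (Quotient.lift CondCauchySeq.limit fun _ _ h => CondCauchySeq.asympOn_top_iff.1 h) (by
    constructor
    · intro x y
      induction x, y using Quotient.inductionOn₂ with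
      | h x y => exact fun h => Quotient.sound (CondCauchySeq.asympOn_top_iff.2 h)
    · intro f
      obtain ⟨x, hx⟩ := CondCauchySeq.exists_limit_eq f
      exact ⟨Quotient.mk _ x, hx⟩)

theorem agreeOn_mk_iff {t : Set Ω} {ht : MeasurableSet t}
    {x y : CondCompletion (MeasureAlgebra μ) X} :
    CondRestrict.agreeOn (MeasureAlgebra.mk μ ⟨t, ht⟩) x y ↔
      ∀ᵐ ω ∂μ, ω ∈ t → equivAEEqFun μ X x ω = equivAEEqFun μ X y ω := by
  induction x, y using Quotient.inductionOn₂ with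
  | h x y => exact CondCauchySeq.asympOn_mk_iff

theorem equivAEEqFun_ofStep_const (e : X) :
    equivAEEqFun μ X (ofStep (StepFun.const (MeasureAlgebra μ) e)) = AEEqFun.const Ω e :=
  CondCauchySeq.limit_ofStep e

theorem equivAEEqFun_le_iff {x y : CondReal (MeasureAlgebra μ)} :
    x ≤ y ↔ ∀ᵐ ω ∂μ, equivAEEqFun μ ℝ x ω ≤ equivAEEqFun μ ℝ y ω := by
  induction x, y using Quotient.inductionOn₂ with
  | h x y => exact CondCauchySeq.le_iff_limit_le

theorem equivAEEqFun_lt_iff {x y : CondReal (MeasureAlgebra μ)} :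
    x < y ↔ ∀ᵐ ω ∂μ, equivAEEqFun μ ℝ x ω < equivAEEqFun μ ℝ y ω := by
  induction x, y using Quotient.inductionOn₂ with
  | h x y => exact CondCauchySeq.lt_iff_limit_lt

variable {E : Type v} [NormedAddCommGroup E] [CompleteSpace E]

theorem equivAEEqFun_add (x y : CondCompletion (MeasureAlgebra μ) E) :
    equivAEEqFun μ E (x + y) = equivAEEqFun μ E x + equivAEEqFun μ E y := by
  induction x, y using Quotient.inductionOn₂ with
  | h x y => exact CondCauchySeq.limit_map₂ _ _ continuous_add x y

theorem equivAEEqFun_smul [NormedSpace ℝ E] (r : CondReal (MeasureAlgebra μ))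
    (x : CondCompletion (MeasureAlgebra μ) E) :
    equivAEEqFun μ E (r • x) = AEEqFun.comp₂ (fun (t : ℝ) (e : E) => t • e) continuous_smul
      (equivAEEqFun μ ℝ r) (equivAEEqFun μ E x) := by
  induction r, x using Quotient.inductionOn₂ with
  | h r x => exact CondCauchySeq.limit_map₂ _ _ continuous_smul r x

theorem equivAEEqFun_norm (x : CondCompletion (MeasureAlgebra μ) E) :
    equivAEEqFun μ ℝ (norm x) =
      AEEqFun.comp (fun e : E => ‖e‖) continuous_norm (equivAEEqFun μ E x) := by
  induction x using Quotient.inductionOn with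
  | h x => exact CondCauchySeq.limit_map _ _ continuous_norm x

theorem equivAEEqFun_mul (r s : CondReal (MeasureAlgebra μ)) :
    equivAEEqFun μ ℝ (r * s) = equivAEEqFun μ ℝ r * equivAEEqFun μ ℝ s :=
  equivAEEqFun_smul r s

theorem equivAEEqFun_one : equivAEEqFun μ ℝ 1 = 1 := equivAEEqFun_ofStep_const 1

theorem equivAEEqFun_zero : equivAEEqFun μ E 0 = 0 := equivAEEqFun_ofStep_const 0

end CondCompletion

/-! ### Strongly measurable functions as a conditional set. -/

namespace MeasureTheory.AEEqFun


section CondRestrict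

variable {X : Type*} [TopologicalSpace X]

/-- Removes the existential choice of a representative: two measurable sets in one class differ by a
null set. -/
theorem agreeOn_mk_iff {t : Set Ω} {ht : MeasurableSet t} {x y : Ω →ₘ[μ] X} :
    CondRestrict.agreeOn (MeasureAlgebra.mk μ ⟨t, ht⟩) x y ↔ ∀ᵐ ω ∂μ, ω ∈ t → x ω = y ω := by
  constructor
  · rintro ⟨⟨s, hs⟩, hst, h⟩
    filter_upwards [MeasureAlgebra.mk_eq_mk_iff.1 hst, h] with ω h1 h2 h3 using h2 (h1.2 h3)
  · exact fun h => ⟨⟨t, ht⟩, rfl, h⟩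

theorem agreeOn_refl (a : MeasureAlgebra μ) (x : Ω →ₘ[μ] X) : CondRestrict.agreeOn a x x := by
  obtain ⟨t, ht, rfl⟩ := MeasureAlgebra.exists_mk a
  exact agreeOn_mk_iff.2 (Eventually.of_forall fun _ _ => rfl)

/-- Countably many measurable pieces give a measurable function, and its range lies in the union of
countably many separable ranges. -/
theorem exists_piecewise [TopologicalSpace.PseudoMetrizableSpace X] {u : Ω → ℕ} (hu : Measurable u)
    (f : ℕ → Ω →ₘ[μ] X) : ∃ g : Ω →ₘ[μ] X, ∀ᵐ ω ∂μ, g ω = f (u ω) ω := by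
  borelize X
  have h : StronglyMeasurable fun ω => f (u ω) ω := by
    rw [stronglyMeasurable_iff_measurable_separable]
    constructor
    · exact (measurable_from_prod_countable_right (f := fun p : ℕ × Ω => f p.1 p.2)
        fun n => (f n).measurable).comp (hu.prodMk measurable_id)
    · refine (TopologicalSpace.IsSeparable.iUnion
        fun n => (f n).stronglyMeasurable.isSeparable_range).mono ?_
      rintro _ ⟨ω, rfl⟩
      exact Set.mem_iUnion.2 ⟨u ω, ω, rfl⟩
  exact ⟨mk _ h.aestronglyMeasurable, coeFn_mk _ _⟩

theorem isConditionalSet [SigmaFinite μ] [TopologicalSpace.PseudoMetrizableSpace X] [Nonempty X] :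
    IsConditionalSet (MeasureAlgebra μ) (Ω →ₘ[μ] X) where
  nonempty := ⟨const Ω (Classical.arbitrary X)⟩
  equivalence a := by
    obtain ⟨t, ht, rfl⟩ := MeasureAlgebra.exists_mk a
    refine ⟨agreeOn_refl _, fun {x y} h => ?_, fun {x y z} h h' => ?_⟩
    · rw [agreeOn_mk_iff] at *
      exact h.mono fun ω hω ht => (hω ht).symm
    · rw [agreeOn_mk_iff] at *
      filter_upwards [h, h'] with ω h1 h2 ht using (h1 ht).trans (h2 ht)
  consistency a b x y hab h := by
    obtain ⟨s, hs, rfl⟩ := MeasureAlgebra.exists_mk a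
    obtain ⟨t, ht, rfl⟩ := MeasureAlgebra.exists_mk b
    rw [agreeOn_mk_iff] at *
    filter_upwards [h, MeasureAlgebra.mk_le_iff.1 hab] with ω h1 h2 hs using h1 (h2 hs)
  stability ι a ha x := by
    -- An empty family is a partition only if `⊤ = ⊥`; then almost everywhere statements are vacuous
    -- and all functions are identified.
    rcases isEmpty_or_nonempty ι with hι | hι
    · have h0 : ∀ᵐ ω ∂μ, False := by
        have := ha.2
        rw [iSup_of_empty, ← MeasureAlgebra.mk_univ, eq_comm,
          MeasureAlgebra.mk_eq_bot_iff_ae] at this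
        filter_upwards [this] with ω hω using hω trivial
      exact ⟨const Ω (Classical.arbitrary X), fun i => isEmptyElim i,
        fun y _ => AEEqFun.ext (h0.mono fun ω h => h.elim)⟩
    · obtain ⟨u, hu, z, hz⟩ := MeasureAlgebra.exists_measurable_refinement ha
      obtain ⟨y, hy⟩ := exists_piecewise hu fun n => x (z n)
      refine ⟨y, fun i => ?_, fun y' hy' => AEEqFun.ext ?_⟩
      · obtain ⟨t, ht, hti⟩ := MeasureAlgebra.exists_mk (a i)
        -- A level set assigned to an index other than `i` meets `a i` in a null set.
        have : ∀ n, ∀ᵐ ω ∂μ, u ω = n → ω ∈ t → z n = i := fun n => by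
          by_cases hn : z n = i
          · exact Eventually.of_forall fun _ _ _ => hn
          · have h0 := le_bot_iff.1 ((inf_le_inf (hz n) hti.le).trans (ha.1 _ _ hn).le)
            rw [MeasureAlgebra.mk_inf, MeasureAlgebra.mk_eq_bot_iff_ae] at h0
            exact h0.mono fun ω hω h1 h2 => (hω ⟨h1, h2⟩).elim
        rw [← hti, agreeOn_mk_iff]
        filter_upwards [hy, ae_all_iff.2 this] with ω h1 h2 hωt
        rw [h1, h2 _ rfl hωt]
      -- For uniqueness the countably many indices `z n` suffice, since their members contain the
      -- level sets of `u`.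
      · have : ∀ n, ∀ᵐ ω ∂μ, u ω = n → y' ω = x (z n) ω := fun n => by
          obtain ⟨t, ht, hti⟩ := MeasureAlgebra.exists_mk (a (z n))
          have h1 := hy' (z n)
          have h2 := hz n
          rw [← hti] at h1 h2
          filter_upwards [agreeOn_mk_iff.1 h1, MeasureAlgebra.mk_le_iff.1 h2]
            with ω h1 h2 hω using h1 (h2 hω)
        filter_upwards [hy, ae_all_iff.2 this] with ω h1 h2
        rw [h1, h2 _ rfl]

end CondRestrict

end MeasureTheory.AEEqFun

/-! ### The limit bijection is stable and identifies the real scalars. -/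

open CondCompletion MeasureTheory.AEEqFun

variable [SigmaFinite μ]

theorem CondCompletion.isStable_equivAEEqFun {X : Type*} [MetricSpace X] [Nonempty X]
    [CompleteSpace X] : IsStable (MeasureAlgebra μ) (equivAEEqFun μ X) := by
  refine IsStable.of_agreeOn fun a x y h => ?_
  obtain ⟨t, ht, rfl⟩ := MeasureAlgebra.exists_mk a
  exact AEEqFun.agreeOn_mk_iff.2 (CondCompletion.agreeOn_mk_iff.1 h)

theorem CondCompletion.isStable_equivAEEqFun_symm {X : Type*} [MetricSpace X] [Nonempty X]
    [CompleteSpace X] : IsStable (MeasureAlgebra μ) (equivAEEqFun μ X).symm := by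
  refine IsStable.of_agreeOn fun a x y h => ?_
  obtain ⟨t, ht, rfl⟩ := MeasureAlgebra.exists_mk a
  rw [CondCompletion.agreeOn_mk_iff]
  simpa using AEEqFun.agreeOn_mk_iff.1 h

variable (μ) in
theorem isCondRealIso_equivAEEqFun_symm : IsCondRealIso μ (equivAEEqFun μ ℝ).symm where
  stable := isStable_equivAEEqFun_symm
  stable_symm := isStable_equivAEEqFun
  map_add x y := by rw [Equiv.symm_apply_eq, equivAEEqFun_add]; simp
  map_mul x y := by rw [Equiv.symm_apply_eq, equivAEEqFun_mul]; simp
  map_one := by rw [Equiv.symm_apply_eq, equivAEEqFun_one]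
  map_abs x := by
    rw [Equiv.symm_apply_eq, CondCompletion.abs, equivAEEqFun_norm, Equiv.apply_symm_apply]
    refine AEEqFun.ext ?_
    filter_upwards [AEEqFun.coeFn_abs x, AEEqFun.coeFn_comp (fun e : ℝ => ‖e‖) continuous_norm x]
      with ω h1 h2
    rw [h1, h2, Function.comp_apply, Real.norm_eq_abs]
  le_iff x y := by
    rw [equivAEEqFun_le_iff, Equiv.apply_symm_apply, Equiv.apply_symm_apply, ← AEEqFun.coeFn_le]
    rfl

/-! ### The Bochner space as a conditional Banach space. -/

section Bochner

variable {E : Type v} [NormedAddCommGroup E] [NormedSpace ℝ E]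

variable (μ E) in
/-- The almost everywhere operations on strongly measurable functions, for the identification
of conditional real numbers with measurable functions by pointwise limits. -/
abbrev aeNormedData : CondNormedData (MeasureAlgebra μ) (Ω →ₘ[μ] E) :=
  bochnerNormedData μ E (equivAEEqFun μ ℝ).symm

theorem coeFn_aeNormedData_smul (r : CondReal (MeasureAlgebra μ)) (x : Ω →ₘ[μ] E) :
    ∀ᵐ ω ∂μ, (aeNormedData μ E).smul r x ω = equivAEEqFun μ ℝ r ω • x ω :=
  AEEqFun.coeFn_comp₂ _ continuous_smul _ _

theorem coeFn_aeNormedData_norm (x : Ω →ₘ[μ] E) :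
    ∀ᵐ ω ∂μ, equivAEEqFun μ ℝ ((aeNormedData μ E).norm x) ω = ‖x ω‖ := by
  have h : equivAEEqFun μ ℝ ((aeNormedData μ E).norm x) =
      AEEqFun.comp (fun e : E => ‖e‖) continuous_norm x := Equiv.apply_symm_apply _ _
  rw [h]
  exact AEEqFun.coeFn_comp _ _ _

theorem coeFn_aeNormedData_dist (x y : Ω →ₘ[μ] E) :
    ∀ᵐ ω ∂μ, equivAEEqFun μ ℝ ((aeNormedData μ E).dist x y) ω = dist (x ω) (y ω) := by
  filter_upwards [coeFn_aeNormedData_norm (x + -y), AEEqFun.coeFn_add x (-y),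
    AEEqFun.coeFn_neg y] with ω h1 h2 h3
  rw [h2, Pi.add_apply, h3, Pi.neg_apply] at h1
  rw [dist_eq_norm, sub_eq_add_neg]
  exact h1

theorem coeFn_equivAEEqFun_add (r s : CondReal (MeasureAlgebra μ)) :
    ∀ᵐ ω ∂μ, equivAEEqFun μ ℝ (r + s) ω = equivAEEqFun μ ℝ r ω + equivAEEqFun μ ℝ s ω := by
  rw [equivAEEqFun_add]
  exact AEEqFun.coeFn_add _ _

theorem coeFn_equivAEEqFun_mul (r s : CondReal (MeasureAlgebra μ)) :
    ∀ᵐ ω ∂μ, equivAEEqFun μ ℝ (r * s) ω = equivAEEqFun μ ℝ r ω * equivAEEqFun μ ℝ s ω := by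
  rw [equivAEEqFun_mul]
  exact AEEqFun.coeFn_mul _ _

theorem coeFn_equivAEEqFun_zero : ∀ᵐ ω ∂μ, equivAEEqFun μ ℝ 0 ω = 0 := by
  rw [equivAEEqFun_zero]
  exact AEEqFun.coeFn_zero

/-- Once a conditional real is read as the function `equivAEEqFun μ ℝ r`, each vector space axiom is
that of `E` at almost every `ω`. -/
theorem isConditionalVectorSpace_aeNormedData :
    (aeNormedData μ E).IsConditionalVectorSpace where
  conditionalSet := AEEqFun.isConditionalSet
  stable_add := by
    refine IsStable.of_agreeOn fun a p q h => ?_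
    obtain ⟨t, ht, rfl⟩ := MeasureAlgebra.exists_mk a
    refine AEEqFun.agreeOn_mk_iff.2 ?_
    filter_upwards [AEEqFun.agreeOn_mk_iff.1 h.1, AEEqFun.agreeOn_mk_iff.1 h.2,
      AEEqFun.coeFn_add p.1 p.2, AEEqFun.coeFn_add q.1 q.2] with ω h1 h2 h3 h4 hω
    exact h3.trans (by rw [Pi.add_apply, h1 hω, h2 hω]; exact h4.symm)
  stable_smul := by
    refine IsStable.of_agreeOn fun a p q h => ?_
    obtain ⟨t, ht, rfl⟩ := MeasureAlgebra.exists_mk a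
    refine AEEqFun.agreeOn_mk_iff.2 ?_
    filter_upwards [CondCompletion.agreeOn_mk_iff.1 h.1, AEEqFun.agreeOn_mk_iff.1 h.2,
      coeFn_aeNormedData_smul p.1 p.2, coeFn_aeNormedData_smul q.1 q.2] with ω h1 h2 h3 h4 hω
    rw [h3, h4, h1 hω, h2 hω]
  add_assoc := add_assoc
  add_comm := add_comm
  add_zero := add_zero
  add_neg x := add_neg_cancel x
  smul_add r x y := by
    refine AEEqFun.ext ?_
    filter_upwards [coeFn_aeNormedData_smul r (x + y), coeFn_aeNormedData_smul r x,
      coeFn_aeNormedData_smul r y, AEEqFun.coeFn_add x y,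
      AEEqFun.coeFn_add ((aeNormedData μ E).smul r x) ((aeNormedData μ E).smul r y)]
      with ω h1 h2 h3 h4 h5
    refine h1.trans (Eq.trans ?_ h5.symm)
    rw [Pi.add_apply, h2, h3, h4, Pi.add_apply, smul_add]
  add_smul r s x := by
    refine AEEqFun.ext ?_
    filter_upwards [coeFn_aeNormedData_smul (r + s) x, coeFn_aeNormedData_smul r x,
      coeFn_aeNormedData_smul s x, coeFn_equivAEEqFun_add r s,
      AEEqFun.coeFn_add ((aeNormedData μ E).smul r x) ((aeNormedData μ E).smul s x)]
      with ω h1 h2 h3 h4 h5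
    refine h1.trans (Eq.trans ?_ h5.symm)
    rw [Pi.add_apply, h2, h3, h4, add_smul]
  mul_smul r s x := by
    refine AEEqFun.ext ?_
    filter_upwards [coeFn_aeNormedData_smul (r * s) x, coeFn_aeNormedData_smul s x,
      coeFn_aeNormedData_smul r ((aeNormedData μ E).smul s x), coeFn_equivAEEqFun_mul r s]
      with ω h1 h2 h3 h4
    rw [h1, h3, h2, h4, mul_smul]
  one_smul x := by
    refine AEEqFun.ext ?_
    have h : ∀ᵐ ω ∂μ, equivAEEqFun μ ℝ 1 ω = 1 := by
      rw [equivAEEqFun_one]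
      exact AEEqFun.coeFn_one
    filter_upwards [coeFn_aeNormedData_smul 1 x, h] with ω h1 h2
    rw [h1, h2, one_smul]

theorem isConditionalNorm_aeNormedData : (aeNormedData μ E).IsConditionalNorm where
  stable_norm := by
    refine IsStable.of_agreeOn fun a x y h => ?_
    obtain ⟨t, ht, rfl⟩ := MeasureAlgebra.exists_mk a
    refine CondCompletion.agreeOn_mk_iff.2 ?_
    filter_upwards [AEEqFun.agreeOn_mk_iff.1 h, coeFn_aeNormedData_norm x,
      coeFn_aeNormedData_norm y] with ω h1 h2 h3 hω
    rw [h2, h3, h1 hω]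
  norm_nonneg x := by
    rw [equivAEEqFun_le_iff]
    filter_upwards [coeFn_equivAEEqFun_zero (μ := μ), coeFn_aeNormedData_norm x] with ω h1 h2
    rw [h1, h2]
    exact _root_.norm_nonneg _
  norm_eq_zero_iff x := by
    rw [← (equivAEEqFun μ ℝ).apply_eq_iff_eq]
    change _ ↔ x = 0
    constructor
    · intro h
      refine AEEqFun.ext ?_
      filter_upwards [coeFn_equivAEEqFun_zero (μ := μ), coeFn_aeNormedData_norm x,
        AEEqFun.coeFn_zero (μ := μ) (α := Ω) (β := E)] with ω h1 h2 h3
      rw [h, h1] at h2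
      rw [h3]
      exact norm_eq_zero.1 h2.symm
    · intro h
      refine AEEqFun.ext ?_
      filter_upwards [coeFn_equivAEEqFun_zero (μ := μ), coeFn_aeNormedData_norm x,
        AEEqFun.coeFn_zero (μ := μ) (α := Ω) (β := E)] with ω h1 h2 h3
      rw [h1, h2, h, h3]
      exact norm_zero
  norm_smul r x := by
    refine (equivAEEqFun μ ℝ).injective (AEEqFun.ext ?_)
    have habs : ∀ᵐ ω ∂μ, equivAEEqFun μ ℝ (CondCompletion.abs r) ω = ‖equivAEEqFun μ ℝ r ω‖ := by
      rw [CondCompletion.abs, equivAEEqFun_norm]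
      exact AEEqFun.coeFn_comp _ _ _
    filter_upwards [coeFn_aeNormedData_norm ((aeNormedData μ E).smul r x),
      coeFn_aeNormedData_norm x, coeFn_aeNormedData_smul r x, habs,
      coeFn_equivAEEqFun_mul (CondCompletion.abs r) ((aeNormedData μ E).norm x)]
      with ω h1 h2 h3 h4 h5
    rw [h1, h5, h2, h3, h4, _root_.norm_smul]
  norm_add_le x y := by
    rw [equivAEEqFun_le_iff]
    filter_upwards [coeFn_aeNormedData_norm (x + y), coeFn_aeNormedData_norm x,
      coeFn_aeNormedData_norm y, AEEqFun.coeFn_add x y,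
      coeFn_equivAEEqFun_add ((aeNormedData μ E).norm x) ((aeNormedData μ E).norm y)]
      with ω h1 h2 h3 h4 h5
    refine h1.trans_le ?_
    rw [h5, h2, h3, h4]
    exact _root_.norm_add_le _ _

theorem aeNormedData_dist_lt_iff {x y : Ω →ₘ[μ] E} {r : CondReal (MeasureAlgebra μ)} :
    (aeNormedData μ E).dist x y < r ↔ ∀ᵐ ω ∂μ, dist (x ω) (y ω) < equivAEEqFun μ ℝ r ω := by
  rw [equivAEEqFun_lt_iff]
  refine eventually_congr ?_
  filter_upwards [coeFn_aeNormedData_dist x y] with ω hω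
  rw [hω]

/-- The members at constant indices are Cauchy in `E` at almost every point, which yields a strongly
measurable limit. For a general radius, `exists_forall_ge_iff` assembles the pointwise thresholds
into one conditional index. -/
theorem isConditionallyComplete_aeNormedData [CompleteSpace E] :
    (aeNormedData μ E).IsConditionallyComplete := by
  intro x hx hc
  have hloc : StepFun.IsLocal fun n => (x n : Ω → E) := fun t ht m n h =>
    AEEqFun.agreeOn_mk_iff.1 (hx.agreeOn StepFun.agreeOn_refl h)
  have hcs := hloc.ae_cauchySeq (μ := μ) fun ε hε => by
    have hr : ∀ᵐ ω ∂μ, equivAEEqFun μ ℝ (CondCompletion.ofStep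
        (StepFun.const (MeasureAlgebra μ) ε)) ω = ε := by
      rw [equivAEEqFun_ofStep_const]
      exact AEEqFun.coeFn_const _ _
    obtain ⟨k, hk⟩ := hc (CondCompletion.ofStep (StepFun.const (MeasureAlgebra μ) ε)) (by
      rw [equivAEEqFun_lt_iff]
      filter_upwards [hr, coeFn_equivAEEqFun_zero (μ := μ)] with ω h1 h2
      rwa [h1, h2])
    refine ⟨k, fun m n hm hn => ?_⟩
    filter_upwards [hr, aeNormedData_dist_lt_iff.1 (hk m n hm hn)] with ω h1 h2
    rwa [h1] at h2
  obtain ⟨f, hf, hlim⟩ := exists_stronglyMeasurable_limit_of_tendsto_ae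
    (fun i => (x (StepFun.const (MeasureAlgebra μ) i)).aestronglyMeasurable)
    (hcs.mono fun ω hω => cauchySeq_tendsto_of_complete hω)
  refine ⟨AEEqFun.mk f hf.aestronglyMeasurable, fun r hr => ?_⟩
  obtain ⟨k, hk⟩ := (StepFun.exists_forall_ge_iff (μ := μ) (P := fun i ω =>
    dist (x (StepFun.const (MeasureAlgebra μ) i) ω) (f ω) < equivAEEqFun μ ℝ r ω) fun i =>
      (measurableSet_lt ((AEEqFun.stronglyMeasurable _).dist hf).measurable
        (AEEqFun.measurable _)).nullMeasurableSet).2 (by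
      filter_upwards [equivAEEqFun_lt_iff.1 hr, coeFn_equivAEEqFun_zero (μ := μ), hlim]
        with ω h1 h2 h3
      rw [h2] at h1
      exact (tendsto_iff_dist_tendsto_zero.1 h3).eventually_lt_const h1)
  refine ⟨k, fun n hn => aeNormedData_dist_lt_iff.2 ?_⟩
  -- The estimate at the standard index given by `n` at `ω` passes to `x n` by locality.
  filter_upwards [hk n hn, hloc.ae_eq n, AEEqFun.coeFn_mk f hf.aestronglyMeasurable]
    with ω h1 h2 h3
  rwa [h2, h3]

theorem isConditionalIsometricIso_equivAEEqFun_symm [CompleteSpace E] :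
    CondNormedData.IsConditionalIsometricIso (aeNormedData μ E)
      (CondCompletion.normedData (MeasureAlgebra μ) E) (equivAEEqFun μ E).symm where
  stable := isStable_equivAEEqFun_symm
  stable_symm := isStable_equivAEEqFun
  map_add x y := by
    rw [Equiv.symm_apply_eq]
    refine Eq.symm ((equivAEEqFun_add _ _).trans ?_)
    rw [Equiv.apply_symm_apply, Equiv.apply_symm_apply]
    rfl
  map_smul r x := by
    rw [Equiv.symm_apply_eq]
    refine Eq.symm ((equivAEEqFun_smul _ _).trans ?_)
    rw [Equiv.apply_symm_apply]
    rfl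
  norm_map x := by
    -- The norm on the Bochner space takes its values through the inverse limit map for `ℝ`, so the
    -- claim is that the limit of the norms is the norm of the limit.
    refine (Equiv.eq_symm_apply _).2 ((equivAEEqFun_norm _).trans ?_)
    rw [Equiv.apply_symm_apply]

end Bochner

end

theorem theoremp {Ω : Type u} [MeasurableSpace Ω] (μ : Measure Ω) [SigmaFinite μ]
    [μ.IsComplete] (E : Type v) [NormedAddCommGroup E] [NormedSpace ℝ E] [CompleteSpace E] :
    ∃ i : (Ω →ₘ[μ] ℝ) ≃ CondReal (MeasureAlgebra μ),
      IsCondRealIso μ i ∧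
      (bochnerNormedData μ E i).IsConditionalBanachSpace ∧
      ∃ j : (Ω →ₘ[μ] E) ≃ CondCompletion (MeasureAlgebra μ) E,
        CondNormedData.IsConditionalIsometricIso (bochnerNormedData μ E i)
          (CondCompletion.normedData (MeasureAlgebra μ) E) j ∧
        ∀ e : E, j (AEEqFun.const Ω e) =
          CondCompletion.ofStep (StepFun.const (MeasureAlgebra μ) e) := by
  -- Both identifications invert the same construction, the pointwise limit, for `ℝ` and for `E`; a
  -- constant sequence of constant step functions has the constant function as its limit.
  refine ⟨(CondCompletion.equivAEEqFun μ ℝ).symm, isCondRealIso_equivAEEqFun_symm μ,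
    ⟨isConditionalVectorSpace_aeNormedData, isConditionalNorm_aeNormedData,
      isConditionallyComplete_aeNormedData⟩, (CondCompletion.equivAEEqFun μ E).symm,
    isConditionalIsometricIso_equivAEEqFun_symm, fun e => ?_⟩
  rw [Equiv.symm_apply_eq, CondCompletion.equivAEEqFun_ofStep_const]
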